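/- Theorem 4.1. Let $f:\mathbb R^n\to\mathbb R$ be $L$-smooth with $L>0$ (differentiable, with $\|\nabla f(x)-\nabla f(y)\|\le L\|x-y\|$ for all $x,y\in\mathbb R^n$; $\|\cdot\|$ is the Euclidean norm) and bounded below. Put $g(x):=x-\frac1L\nabla f(x)$ and $h(x):=g(x)-x$. Fix a memory parameter $m\ge 1$ and constants $\gamma,c_1,c_3>0$, $0<c_2<\frac1{2mL}$, $\nu\in(2,3)$. For each $k\ge0$ write $\hat m=\hat m(k):=k \bmod (m+1)$. Let $\{x^k\}_{k\ge0}$ be generated from an arbitrary $x^0\in\mathbb R^n$ by the following globalized restarted Anderson acceleration scheme. If $\hat m=0$, set $x^{k+1}=g(x^k)$. If $\hat m\neq0$, choose a minimizer $\alpha^k\in\mathbb R^{\hat m}$ of $$\Big\|h(x^{k-\hat m})+\sum_{i=1}^{\hat m}\alpha_i\big(h(x^{k-\hat m+i})-h(x^{k-\hat m})\big)\Big\|^2,$$ form the AA step $$x^k_{AA}=g(x^{k-\hat m})+\sum_{i=1}^{\hat m}\alpha^k_i\big(g(x^{k-\hat m+i})-g(x^{k-\hat m})\big),$$ accept it, i.e.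 set $x^{k+1}=x^k_{AA}$, if $$f(x^k_{AA})\le f(x^k)-\gamma\|\nabla f(x^k)\|^2+\min\{c_1\|\nabla f(x^{k-\hat m})\|^{\nu},\,c_2\|\nabla f(x^{k-\hat m})\|^2,\,c_3\},$$ and otherwise reject it and set $x^{k+1}=g(x^k)$. Then $$\sum_{k=0}^\infty\|\nabla f(x^k)\|^2<\infty\qquad\text{and}\qquad\lim_{k\to\infty}\|\nabla f(x^k)\|=0.$$ Suppose in addition that $\gamma<\frac1{2L}$, that $x^\star$ is an accumulation point of the sequence $\{x^{k(m+1)}\}_k$ of cycle starts, and that there are $r,\mu>0$ and $L_H,M\in\mathbb R$ such that - $f$ is $\mu$-strongly convex on $\mathbb B_r(x^\star):=\{x:\|x-x^\star\|<r\}$; - the Hessian $\nabla^2 f$ exists on $\mathbb B_r(x^\star)$ and is Lipschitz continuous there with modulus $L_H$ (in the spectral norm); - for every $k$ with $\hat m\ne0$, the matrix $X_k:=[x^{k-\hat m+1}-x^{k-\hat m},\dots,x^k-x^{k-\hat m}]\in\mathbb R^{n\times\hat m}$ satisfies $\kappa(X_k^\top X_k)\le M^2$, where $\kappa(A):=\sigma_{\max}(A)/\sigma_{\min}(A)$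 is the condition number ($+\infty$ if $A$ is singular). Then $x^k\to x^\star$, and all AA steps are eventually accepted: there is $K$ such that for every $k\ge K$ with $\hat m\ne0$ the AA step $x^k_{AA}$ satisfies the acceptance condition and $x^{k+1}=x^k_{AA}$. In particular the scheme eventually turns into the restarted Anderson acceleration scheme without globalization: for some $s$, the sequence $y^k:=x^{s(m+1)+k}$ satisfies, for all $k\ge 0$, $y^{k+1}=g(y^k)$ if $\hat m(k)=0$, and otherwise $y^{k+1}=g(y^{k-\hat m})+\sum_{i=1}^{\hat m}\beta_i\big(g(y^{k-\hat m+i})-g(y^{k-\hat m})\big)$ for some minimizer $\beta$ of $\big\|h(y^{k-\hat m})+\sum_{i=1}^{\hat m}\beta_i(h(y^{k-\hat m+i})-h(y^{k-\hat m}))\big\|^2$ over $\mathbb R^{\hat m}$. -/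

import Mathlib

open Filter Topology Matrix

noncomputable section

namespace AndersonRestart

/-- `f` is `L`-smooth on `ℝⁿ`: it is differentiable and its gradient is Lipschitz with modulus `L`. -/
def IsLSmooth {n : ℕ} (f : EuclideanSpace ℝ (Fin n) → ℝ) (L : ℝ) : Prop :=
  Differentiable ℝ f ∧ ∀ x y, ‖gradient f x - gradient f y‖ ≤ L * ‖x - y‖

/-- The Hessian of `f` (the derivative of the gradient map) exists at every point of `s` and is
Lipschitz with modulus `LH` on `s`, with respect to the operator (spectral) norm. -/
def HessianLipschitzOn {n : ℕ} (f : EuclideanSpace ℝ (Fin n) → ℝ) (LH : ℝ)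
    (s : Set (EuclideanSpace ℝ (Fin n))) : Prop :=
  (∀ x ∈ s, DifferentiableAt ℝ (gradient f) x) ∧
    ∀ x ∈ s, ∀ y ∈ s,
      ‖fderiv ℝ (gradient f) x - fderiv ℝ (gradient f) y‖ ≤ LH * ‖x - y‖

/-- The gradient step map `g(x) = x - ∇f(x) / L`. -/
def gradStep {n : ℕ} (f : EuclideanSpace ℝ (Fin n) → ℝ) (L : ℝ)
    (x : EuclideanSpace ℝ (Fin n)) : EuclideanSpace ℝ (Fin n) :=
  x - (1 / L) • gradient f x

/-- The residual map `h(x) = g(x) - x`. -/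
def residual {n : ℕ} (f : EuclideanSpace ℝ (Fin n) → ℝ) (L : ℝ)
    (x : EuclideanSpace ℝ (Fin n)) : EuclideanSpace ℝ (Fin n) :=
  gradStep f L x - x

/-- The current depth `m̂ = mod (k, m + 1)`. -/
abbrev depth (m k : ℕ) : ℕ := k % (m + 1)

/-- The difference `u^{k - m̂ + j} - u^{k - m̂}`, `j = 1, …, m̂`; the index `j` is shifted by one. -/
def diffCol {n : ℕ} (m : ℕ) (u : ℕ → EuclideanSpace ℝ (Fin n)) (k : ℕ) (j : Fin (depth m k)) :
    EuclideanSpace ℝ (Fin n) :=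
  u (k - depth m k + (j + 1)) - u (k - depth m k)

/-- The `n × m̂` matrix `[u^{k - m̂ + 1} - u^{k - m̂}, …, u^k - u^{k - m̂}]`. It is `X_k` when `u` is
the sequence of iterates itself. -/
def diffMatrix {n : ℕ} (m : ℕ) (u : ℕ → EuclideanSpace ℝ (Fin n)) (k : ℕ) :
    Matrix (Fin n) (Fin (depth m k)) ℝ :=
  Matrix.of fun i j => diffCol m u k j i

/-- The condition number `σ_max(A) / σ_min(A)` of a square matrix of size `p ≥ 1`, equal to `∞` if
`A` is singular. The singular values are listed in decreasing order, from index `0` to `p - 1`. -/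
def condNumber {p : ℕ} (A : Matrix (Fin p) (Fin p) ℝ) : ENNReal :=
  if (Matrix.toEuclideanLin A).singularValues (p - 1) = 0 then ⊤
  else ENNReal.ofReal ((Matrix.toEuclideanLin A).singularValues 0 /
    (Matrix.toEuclideanLin A).singularValues (p - 1))

/-- The condition number of `X_kᵀ X_k` is at most `M²` for every `k` for which `X_k` has a column. -/
def CondBound {n : ℕ} (m : ℕ) (x : ℕ → EuclideanSpace ℝ (Fin n)) (M : ℝ) : Prop :=
  ∀ k, depth m k ≠ 0 →
    condNumber ((diffMatrix m x k)ᵀ * diffMatrix m x k) ≤ ENNReal.ofReal (M ^ 2)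

/-- `α` solves the mixing problem `min_α ‖h^{k - m̂} + ∑ⱼ αⱼ (h^{k - m̂ + j} - h^{k - m̂})‖²`. -/
def IsMixing {n : ℕ} (f : EuclideanSpace ℝ (Fin n) → ℝ) (L : ℝ) (m : ℕ)
    (x : ℕ → EuclideanSpace ℝ (Fin n)) (k : ℕ) (α : Fin (depth m k) → ℝ) : Prop :=
  ∀ β : Fin (depth m k) → ℝ,
    ‖residual f L (x (k - depth m k)) +
        ∑ j, α j • diffCol m (fun i => residual f L (x i)) k j‖ ^ 2 ≤
      ‖residual f L (x (k - depth m k)) +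
        ∑ j, β j • diffCol m (fun i => residual f L (x i)) k j‖ ^ 2

/-- `z` is an Anderson accelerated step at iteration `k`: `z = g^{k - m̂} + G_k α` for a solution
`α` of the mixing problem (which need not be unique). -/
def IsAAStep {n : ℕ} (f : EuclideanSpace ℝ (Fin n) → ℝ) (L : ℝ) (m : ℕ)
    (x : ℕ → EuclideanSpace ℝ (Fin n)) (k : ℕ) (z : EuclideanSpace ℝ (Fin n)) : Prop :=
  ∃ α : Fin (depth m k) → ℝ, IsMixing f L m x k α ∧
    z = gradStep f L (x (k - depth m k)) +
      ∑ j, α j • diffCol m (fun i => gradStep f L (x i)) k j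

/-- `x` is generated by Anderson acceleration with restarting (no globalization). -/
structure IsAAR {n : ℕ} (f : EuclideanSpace ℝ (Fin n) → ℝ) (L : ℝ) (m : ℕ)
    (x : ℕ → EuclideanSpace ℝ (Fin n)) : Prop where
  restart : ∀ k, depth m k = 0 → x (k + 1) = gradStep f L (x k)
  step : ∀ k, depth m k ≠ 0 → IsAAStep f L m x k (x (k + 1))

/-- The sufficient decrease condition under which the candidate `z` is accepted at iteration `k`. -/
def Accepted {n : ℕ} (f : EuclideanSpace ℝ (Fin n) → ℝ) (m : ℕ) (γ ν c₁ c₂ c₃ : ℝ)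
    (x : ℕ → EuclideanSpace ℝ (Fin n)) (k : ℕ) (z : EuclideanSpace ℝ (Fin n)) : Prop :=
  f z ≤ f (x k) - γ * ‖gradient f (x k)‖ ^ 2 +
    min (c₁ * ‖gradient f (x (k - depth m k))‖ ^ ν)
      (min (c₂ * ‖gradient f (x (k - depth m k))‖ ^ 2) c₃)

/-- `x` is generated by the function-value-globalized scheme, with `z k` the Anderson step computed
at iteration `k` (the values `z k` at the cycle starts play no role). -/
structure IsGlobalizedAAR {n : ℕ} (f : EuclideanSpace ℝ (Fin n) → ℝ) (L : ℝ) (m : ℕ)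
    (γ ν c₁ c₂ c₃ : ℝ) (x z : ℕ → EuclideanSpace ℝ (Fin n)) : Prop where
  restart : ∀ k, depth m k = 0 → x (k + 1) = gradStep f L (x k)
  candidate : ∀ k, depth m k ≠ 0 → IsAAStep f L m x k (z k)
  reject : ∀ k, depth m k ≠ 0 → ¬ Accepted f m γ ν c₁ c₂ c₃ x k (z k) →
    x (k + 1) = gradStep f L (x k)
  accept : ∀ k, depth m k ≠ 0 → Accepted f m γ ν c₁ c₂ c₃ x k (z k) → x (k + 1) = z k

end AndersonRestart

end

open scoped InnerProductSpace

/-! Summability. A gradient step lowers `f` by at least `1 / (2 * L)` times the squared gradient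
norm, each later step of a cycle raises `f` by at most `c₂` times the squared gradient norm at the
cycle start, and `m * c₂ < 1 / (2 * L)`. Hence every cycle loses a fixed multiple of the sum of its
squared gradient norms (`cycle_decrease`), and `f` is bounded below.

Acceptance. Take cycles starting near `xstar`, with `t` the gradient norm at the start. By strong
convexity, `f z` is at most `f (g x)` minus `⟪∇f z, g x - z⟫`, and `g x` has the decrease factor `1
/ (2 * L) > γ`. So it suffices to bound this inner product below by `-ε ‖∇f x‖ ^ 2 - C t ^ 3`: the
slack `1 / (2 * L) - γ` pays for the first error, and the relaxation, as `ν < 3`, for the second.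
The condition number bound keeps increments of order `t` and mixing coefficients bounded, so a cycle
is, up to `O(t ^ 2)`, Anderson acceleration for the linear field given by the Hessian `A`
(`IsNearlyLinearAA`). The inner product then reduces to the form in `gain_lower_bound`, whose terms
compensate if the last mixing coefficient is at least one and the memory term pairs nonpositively
with the mixed residual.

For an exactly linear field both facts hold: the first by Cauchy–Schwarz and cocoercivity
(`one_le_coeff`), the second by a short recurrence that comes from the symmetry of `A`
(`inner_memoryTerm_nonpos`). They transfer by compactness, as rescaled runs have linear limits along
ultrafilters (`exists_limit`). Limits only control errors relative to `t ^ 2`, while the last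
residual may be far smaller than `t`; the exact identity `inner_mul_sq_eq` bridges these scales.

Convergence. If a start is close to `xstar`, acceptance puts the next start nearby. Since `f`
decreases along starts and grows quadratically around `xstar`, the starts are trapped there
(`tendsto_start`). -/

namespace AndersonRestart

/-! ### Descent for `L`-smooth functions. -/

section Gradient

variable {n : ℕ} {f : EuclideanSpace ℝ (Fin n) → ℝ} {L : ℝ}

lemma IsLSmooth.lipschitzWith (hL : 0 < L) (hf : IsLSmooth f L) :
    LipschitzWith (Real.toNNReal L) (gradient f) := by
  refine LipschitzWith.of_dist_le_mul fun x y => ?_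
  rw [dist_eq_norm, dist_eq_norm, Real.coe_toNNReal L hL.le]
  exact hf.2 x y

/-- Derivative of `f` along a line. -/
lemma hasDerivAt_line (hf : Differentiable ℝ f) (x d : EuclideanSpace ℝ (Fin n)) (s : ℝ) :
    HasDerivAt (fun s : ℝ => f (x + s • d)) ⟪gradient f (x + s • d), d⟫_ℝ s := by
  have h1 : HasFDerivAt f _ (x + s • d) := (hf (x + s • d)).hasGradientAt.hasFDerivAt
  have h2 : HasDerivAt (fun s : ℝ => x + s • d) d s := by
    simpa using ((hasDerivAt_id s).smul_const d).const_add x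
  exact h1.comp_hasDerivAt s h2

/-- The descent lemma. -/
lemma descent_lemma (hf : IsLSmooth f L) (x y : EuclideanSpace ℝ (Fin n)) :
    f y ≤ f x + ⟪gradient f x, y - x⟫_ℝ + L / 2 * ‖y - x‖ ^ 2 := by
  set d := y - x with hd
  let φ : ℝ → ℝ := fun s => f (x + s • d) - s * ⟪gradient f x, d⟫_ℝ - L / 2 * s ^ 2 * ‖d‖ ^ 2
  have hder : ∀ s, HasDerivAt φ
      (⟪gradient f (x + s • d), d⟫_ℝ - ⟪gradient f x, d⟫_ℝ - L * s * ‖d‖ ^ 2) s := by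
    intro s
    have h1 := hasDerivAt_line hf.1 x d s
    have h2 := (hasDerivAt_id s).mul_const ⟪gradient f x, d⟫_ℝ
    have h3 := (((hasDerivAt_id s).pow 2).const_mul (L / 2)).mul_const (‖d‖ ^ 2)
    refine ((h1.sub h2).sub h3).congr_deriv ?_
    simp only [id, Nat.cast_ofNat]
    ring
  have hanti : AntitoneOn φ (Set.Icc 0 1) := by
    refine antitoneOn_of_deriv_nonpos (convex_Icc 0 1)
      (fun s _ => (hder s).continuousAt.continuousWithinAt)
      (fun s _ => (hder s).differentiableAt.differentiableWithinAt) fun s hs => ?_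
    rw [interior_Icc] at hs
    rw [(hder s).deriv, ← inner_sub_left]
    have h1 := real_inner_le_norm (gradient f (x + s • d) - gradient f x) d
    have h2 := hf.2 (x + s • d) x
    rw [add_sub_cancel_left, norm_smul, Real.norm_of_nonneg hs.1.le] at h2
    nlinarith [mul_le_mul_of_nonneg_right h2 (norm_nonneg d)]
  have := hanti (by simp : (0:ℝ) ∈ Set.Icc 0 1) (by simp : (1:ℝ) ∈ Set.Icc 0 1) zero_le_one
  simp only [φ, hd, one_smul, zero_smul, add_zero, add_sub_cancel] at this
  rw [← hd] at this
  linarith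

lemma gradStep_descent (hL : 0 < L) (hf : IsLSmooth f L) (x : EuclideanSpace ℝ (Fin n)) :
    f (gradStep f L x) ≤ f x - 1 / (2 * L) * ‖gradient f x‖ ^ 2 := by
  have h := descent_lemma hf x (gradStep f L x)
  have e : gradStep f L x - x = -((1 / L) • gradient f x) := by simp [gradStep]
  rw [e, inner_neg_right, inner_smul_right, real_inner_self_eq_norm_sq, norm_neg, norm_smul,
    Real.norm_of_nonneg (by positivity)] at h
  refine h.trans (le_of_eq ?_)
  field_simp
  ring

lemma residual_eq (x : EuclideanSpace ℝ (Fin n)) :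
    residual f L x = -((1 / L) • gradient f x) := by
  simp [residual, gradStep]

end Gradient

/-! ### Decrease over a cycle and summability of the squared gradients. -/

section Global

variable {n : ℕ} {f : EuclideanSpace ℝ (Fin n) → ℝ} {L : ℝ} {m : ℕ} {γ ν c₁ c₂ c₃ : ℝ}
  {x z : ℕ → EuclideanSpace ℝ (Fin n)}

lemma depth_cycle (l : ℕ) {i : ℕ} (hi : i ≤ m) : depth m (l * (m + 1) + i) = i := by
  rw [depth, add_comm, Nat.add_mul_mod_self_right, Nat.mod_eq_of_lt (by omega)]

/-- The minimum of `γ` and `1 / (2 * L)` covers acceptance and rejection together. Of the relaxation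
only the quadratic term is kept, since it can be charged to the gradient step at the cycle start. -/
lemma step_decrease (hL : 0 < L) (hf : IsLSmooth f L) (hc₂ : 0 < c₂)
    (hx : IsGlobalizedAAR f L m γ ν c₁ c₂ c₃ x z) (l : ℕ) {i : ℕ} (hi : i ≤ m) (hi0 : i ≠ 0) :
    f (x (l * (m + 1) + i + 1)) ≤ f (x (l * (m + 1) + i))
      - min γ (1 / (2 * L)) * ‖gradient f (x (l * (m + 1) + i))‖ ^ 2
      + c₂ * ‖gradient f (x (l * (m + 1)))‖ ^ 2 := by
  have hd := depth_cycle l hi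
  have hd0 : depth m (l * (m + 1) + i) ≠ 0 := by rwa [hd]
  by_cases hacc : Accepted f m γ ν c₁ c₂ c₃ x (l * (m + 1) + i) (z (l * (m + 1) + i))
  · rw [hx.accept _ hd0 hacc]
    unfold Accepted at hacc
    rw [hd, Nat.add_sub_cancel] at hacc
    have h1 : min (c₁ * ‖gradient f (x (l * (m + 1)))‖ ^ ν)
      (min (c₂ * ‖gradient f (x (l * (m + 1)))‖ ^ 2) c₃) ≤
        c₂ * ‖gradient f (x (l * (m + 1)))‖ ^ 2 := (min_le_right _ _).trans (min_le_left _ _)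
    nlinarith [mul_le_mul_of_nonneg_right (min_le_left γ (1 / (2 * L)))
      (sq_nonneg ‖gradient f (x (l * (m + 1) + i))‖)]
  · rw [hx.reject _ hd0 hacc]
    have h1 := gradStep_descent hL hf (x (l * (m + 1) + i))
    nlinarith [mul_le_mul_of_nonneg_right (min_le_right γ (1 / (2 * L)))
      (sq_nonneg ‖gradient f (x (l * (m + 1) + i))‖),
      mul_nonneg hc₂.le (sq_nonneg ‖gradient f (x (l * (m + 1)))‖)]

/-- Decrease of `f` over the first `i + 1` steps of a cycle. -/
lemma cycle_partial_decrease (hL : 0 < L) (hf : IsLSmooth f L) (hc₂ : 0 < c₂)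
    (hx : IsGlobalizedAAR f L m γ ν c₁ c₂ c₃ x z) (l : ℕ) (i : ℕ) (hi : i ≤ m) :
    f (x (l * (m + 1) + i + 1)) ≤ f (x (l * (m + 1)))
      - (1 / (2 * L) - i * c₂) * ‖gradient f (x (l * (m + 1)))‖ ^ 2
      - min γ (1 / (2 * L)) *
        ∑ j ∈ Finset.range i, ‖gradient f (x (l * (m + 1) + (j + 1)))‖ ^ 2 := by
  induction i with
  | zero =>
    have h := hx.restart (l * (m + 1) + 0) (depth_cycle l hi)
    rw [h]
    simpa using gradStep_descent hL hf (x (l * (m + 1)))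
  | succ i ih =>
    have h := step_decrease hL hf hc₂ hx l hi (by omega)
    have ih := ih (by omega)
    rw [Finset.sum_range_succ]
    rw [← add_assoc] at h ⊢
    push_cast
    nlinarith

/-- The decrease of `f` over a whole cycle controls all squared gradient norms in that cycle. -/
lemma cycle_decrease (hL : 0 < L) (hf : IsLSmooth f L) (hm : 1 ≤ m) (hγ : 0 < γ) (hc₂ : 0 < c₂)
    (hc₂' : c₂ < 1 / (2 * (m : ℝ) * L)) (hx : IsGlobalizedAAR f L m γ ν c₁ c₂ c₃ x z) :
    ∃ δ : ℝ, 0 < δ ∧ ∀ l, f (x ((l + 1) * (m + 1))) ≤ f (x (l * (m + 1)))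
      - δ * ∑ j ∈ Finset.range (m + 1), ‖gradient f (x (l * (m + 1) + j))‖ ^ 2 := by
  have hm' : (0 : ℝ) < m := by exact_mod_cast hm
  -- The bound on `c₂` lets the first gradient step of the cycle pay for all `m` relaxations.
  have h1 : 0 < 1 / (2 * L) - m * c₂ := by
    rw [lt_div_iff₀ (by positivity)] at hc₂'
    rw [sub_pos, lt_div_iff₀ (by positivity)]
    linarith
  have h2 : 0 < min γ (1 / (2 * L)) := lt_min hγ (by positivity)
  refine ⟨min (1 / (2 * L) - m * c₂) (min γ (1 / (2 * L))), lt_min h1 h2, fun l => ?_⟩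
  have h := cycle_partial_decrease hL hf hc₂ hx l m le_rfl
  have e : (l + 1) * (m + 1) = l * (m + 1) + m + 1 := by ring
  rw [e, Finset.sum_range_succ', add_zero]
  have h3 := mul_le_mul_of_nonneg_right
    (min_le_left (1 / (2 * L) - m * c₂) (min γ (1 / (2 * L))))
    (sq_nonneg ‖gradient f (x (l * (m + 1)))‖)
  have h4 := mul_le_mul_of_nonneg_right
    (min_le_right (1 / (2 * L) - m * c₂) (min γ (1 / (2 * L))))
    (Finset.sum_nonneg fun j (_ : j ∈ Finset.range m) =>
      sq_nonneg ‖gradient f (x (l * (m + 1) + (j + 1)))‖)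
  linarith

lemma summable_sq_gradient (hL : 0 < L) (hf : IsLSmooth f L) (hbdd : BddBelow (Set.range f))
    (hm : 1 ≤ m) (hγ : 0 < γ) (hc₂ : 0 < c₂)
    (hc₂' : c₂ < 1 / (2 * (m : ℝ) * L)) (hx : IsGlobalizedAAR f L m γ ν c₁ c₂ c₃ x z) :
    Summable (fun k => ‖gradient f (x k)‖ ^ 2) := by
  obtain ⟨δ, hδ, h⟩ := cycle_decrease hL hf hm hγ hc₂ hc₂' hx
  obtain ⟨b, hb⟩ := hbdd
  have hsum : ∀ l, δ * ∑ k ∈ Finset.range (l * (m + 1)), ‖gradient f (x k)‖ ^ 2 ≤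
      f (x 0) - f (x (l * (m + 1))) := by
    intro l
    induction l with
    | zero => simp
    | succ l ih =>
      have h := h l
      have e : (l + 1) * (m + 1) = l * (m + 1) + (m + 1) := by ring
      rw [e] at h ⊢
      rw [Finset.sum_range_add]
      linarith
  refine summable_of_sum_range_le (c := (f (x 0) - b) / δ) (fun k => sq_nonneg _) fun N => ?_
  have h1 : ∑ k ∈ Finset.range N, ‖gradient f (x k)‖ ^ 2 ≤
      ∑ k ∈ Finset.range (N * (m + 1)), ‖gradient f (x k)‖ ^ 2 :=
    Finset.sum_le_sum_of_subset_of_nonneg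
      (Finset.range_mono (Nat.le_mul_of_pos_right N (by omega))) fun _ _ _ => sq_nonneg _
  rw [le_div_iff₀ hδ]
  have h2 := hsum N
  have h3 : b ≤ f (x (N * (m + 1))) := hb ⟨_, rfl⟩
  nlinarith

lemma tendsto_norm_gradient (h : Summable (fun k => ‖gradient f (x k)‖ ^ 2)) :
    Tendsto (fun k => ‖gradient f (x k)‖) atTop (𝓝 0) := by
  have := h.tendsto_atTop_zero.sqrt
  simpa using this

end Global

/-! ### The exactly linear case: search spaces and signs. -/

section Krylov

variable {E : Type*} [NormedAddCommGroup E] [InnerProductSpace ℝ E]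

/-- The span of the first `j` vectors of a sequence. -/
def initialSpan (X : ℕ → E) (j : ℕ) : Submodule ℝ E := Submodule.span ℝ (X '' Set.Iio j)

variable {X R D : ℕ → E} {a : ℕ → ℝ} {A : E →L[ℝ] E} {L : ℝ} {k : ℕ}

lemma mem_initialSpan {i j : ℕ} (h : i < j) : X i ∈ initialSpan X j :=
  Submodule.subset_span ⟨i, h, rfl⟩

lemma initialSpan_mono {i j : ℕ} (h : i ≤ j) : initialSpan X i ≤ initialSpan X j :=
  Submodule.span_mono (Set.image_mono (Set.Iio_subset_Iio h))

lemma eq_zero_of_mem_initialSpan_zero {y : E} (hy : y ∈ initialSpan X 0) : y = 0 := by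
  simpa [initialSpan] using hy

lemma exists_of_mem_initialSpan_succ {j : ℕ} {y : E} (hy : y ∈ initialSpan X (j + 1)) :
    ∃ (c : ℝ) (y' : E), y' ∈ initialSpan X j ∧ y = c • X j + y' := by
  have : Set.Iio (j + 1) = insert j (Set.Iio j) := by
    ext; simp only [Set.mem_Iio, Set.mem_insert_iff]; omega
  rw [initialSpan, this, Set.image_insert_eq, Submodule.mem_span_insert] at hy
  obtain ⟨c, y', hy', h⟩ := hy
  exact ⟨c, y', hy', h⟩

lemma sum_mem_initialSpan (b : ℕ → ℝ) (j : ℕ) :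
    ∑ i ∈ Finset.range j, b i • X i ∈ initialSpan X j :=
  Submodule.sum_mem _ fun _ hi =>
    Submodule.smul_mem _ _ (mem_initialSpan (Finset.mem_range.1 hi))

lemma exists_sum_of_mem_initialSpan {j : ℕ} {y : E} (hy : y ∈ initialSpan X j) :
    ∃ b : ℕ → ℝ, y = ∑ i ∈ Finset.range j, b i • X i := by
  induction j generalizing y with
  | zero => exact ⟨0, by simpa using eq_zero_of_mem_initialSpan_zero hy⟩
  | succ j ih =>
    obtain ⟨c, y', hy', rfl⟩ := exists_of_mem_initialSpan_succ hy
    obtain ⟨b, rfl⟩ := ih hy'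
    refine ⟨Function.update b j c, ?_⟩
    rw [Finset.sum_range_succ, Function.update_self, add_comm]
    congr 1
    refine Finset.sum_congr rfl fun i hi => ?_
    rw [Function.update_of_ne (Finset.mem_range.1 hi).ne]

/-- Pairing a vector of the search space with the later residuals gives a fixed multiple of their
squared norms. -/
lemma exists_inner_eq_mul_sq (hD : ∀ j < k, D j ∈ initialSpan X j)
    (hX : ∀ j < k, X j = D j - (1 / L) • R j)
    (hRR : ∀ j ≤ k, ∀ i ≤ j, ⟪R j, R i⟫_ℝ = ‖R j‖ ^ 2) {i : ℕ} (hi : i ≤ k) {y : E}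
    (hy : y ∈ initialSpan X i) :
    ∃ s : ℝ, ∀ j ≤ k, i ≤ j + 1 → ⟪R j, y⟫_ℝ = s * ‖R j‖ ^ 2 := by
  induction i generalizing y with
  | zero => exact ⟨0, by simp [eq_zero_of_mem_initialSpan_zero hy]⟩
  | succ i ih =>
    obtain ⟨c, y', hy', rfl⟩ := exists_of_mem_initialSpan_succ hy
    obtain ⟨s, hs⟩ := ih (by omega)
      (Submodule.add_mem _ (Submodule.smul_mem _ c (hD i (by omega))) hy')
    refine ⟨s - c / L, fun j hj hij => ?_⟩
    have h := hs j hj (by omega)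
    -- Replacing `X i` by `D i - R i / L` leaves a vector of the shorter span and a multiple of `R
    -- i`, whose pairing with every later residual is the same multiple of the squared norm.
    have e : c • X i + y' = (c • D i + y') - (c / L) • R i := by
      rw [hX i (by omega)]; module
    rw [e, inner_sub_right, h, inner_smul_right, hRR j hj i (by omega)]
    ring

/-- The factor `s` of the previous lemma does not depend on the residual, so comparing `j` with `j +
1` eliminates it. Being exact, the identity carries signs from one residual to the next at the scale
of the latter. -/
lemma inner_mul_sq_eq (hD : ∀ j < k, D j ∈ initialSpan X j)
    (hX : ∀ j < k, X j = D j - (1 / L) • R j)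
    (hRR : ∀ j ≤ k, ∀ i ≤ j, ⟪R j, R i⟫_ℝ = ‖R j‖ ^ 2) {j : ℕ} (hj : j + 1 ≤ k) {y : E}
    (hy : y ∈ initialSpan X (j + 1)) :
    ⟪R (j + 1), y⟫_ℝ * ‖R j‖ ^ 2 = ‖R (j + 1)‖ ^ 2 * ⟪R j, y⟫_ℝ := by
  obtain ⟨s, hs⟩ := exists_inner_eq_mul_sq hD hX hRR hj hy
  rw [hs (j + 1) hj (by omega), hs j (by omega) le_rfl]
  ring

/-- Restarted Anderson acceleration for the gradient field of a quadratic function with Hessian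
`A`: increments `X`, mixed increments `D` and mixed residuals `R`, with `a j` the last mixing
coefficient at depth `j + 1`. -/
structure IsLinearAA (A : E →L[ℝ] E) (L : ℝ) (k : ℕ) (X R D : ℕ → E) (a : ℕ → ℝ) : Prop where
  D_zero : D 0 = 0
  D_succ : ∀ j < k, D (j + 1) - a j • X j ∈ initialSpan X j
  R_eq : ∀ j ≤ k, R j = R 0 + A (D j)
  orth : ∀ j ≤ k, ∀ i < j, ⟪R j, A (X i)⟫_ℝ = 0
  X_eq : ∀ j < k, X j = D j - (1 / L) • R j
  indep : ∀ j < k, X j ∉ initialSpan X j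

/-- The component of `D (j + 1) - D j` in the search space of depth `j`. -/
noncomputable def memoryTerm (L : ℝ) (R D : ℕ → E) (a : ℕ → ℝ) (j : ℕ) : E :=
  D (j + 1) - D j + (a j / L) • R j

lemma diff_eq_memoryTerm_sub (j : ℕ) : D (j + 1) - D j = memoryTerm L R D a j - (a j / L) • R j := by
  rw [memoryTerm]; abel

namespace IsLinearAA

variable (h : IsLinearAA A L k X R D a)
include h

lemma D_mem {j : ℕ} (hj : j ≤ k) : D j ∈ initialSpan X j := by
  cases j with
  | zero => rw [h.D_zero]; exact Submodule.zero_mem _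
  | succ j =>
    have h1 := initialSpan_mono (X := X) (Nat.le_succ j) (h.D_succ j (by omega))
    have h2 := Submodule.smul_mem (initialSpan X (j + 1)) (a j)
      (mem_initialSpan (X := X) (Nat.lt_succ_self j))
    simpa using Submodule.add_mem _ h1 h2

lemma inner_map_eq_zero {j : ℕ} (hj : j ≤ k) {y : E} (hy : y ∈ initialSpan X j) :
    ⟪R j, A y⟫_ℝ = 0 := by
  obtain ⟨b, rfl⟩ := exists_sum_of_mem_initialSpan hy
  rw [map_sum, inner_sum]
  refine Finset.sum_eq_zero fun i hi => ?_
  rw [map_smul, inner_smul_right, h.orth j hj i (Finset.mem_range.1 hi), mul_zero]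

/-- The difference of two residuals is the image under `A` of a search vector, to which the later
residual is orthogonal. -/
lemma inner_R_R {j : ℕ} (hj : j ≤ k) {i : ℕ} (hi : i ≤ j) : ⟪R j, R i⟫_ℝ = ‖R j‖ ^ 2 := by
  have e : R i = R j - A (D j - D i) := by
    rw [h.R_eq i (by omega), h.R_eq j hj, map_sub]; abel
  rw [e, inner_sub_right, h.inner_map_eq_zero hj, real_inner_self_eq_norm_sq, sub_zero]
  exact Submodule.sub_mem _ (h.D_mem hj) (initialSpan_mono hi (h.D_mem (by omega)))

lemma memoryTerm_mem {j : ℕ} (hj : j < k) : memoryTerm L R D a j ∈ initialSpan X j := by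
  have e : memoryTerm L R D a j = (D (j + 1) - a j • X j) + (a j • D j - D j) := by
    rw [memoryTerm, h.X_eq j hj]; module
  rw [e]
  have hD := h.D_mem hj.le
  exact Submodule.add_mem _ (h.D_succ j hj)
    (Submodule.sub_mem _ (Submodule.smul_mem _ _ hD) hD)

lemma map_diff_eq {j : ℕ} (hj : j < k) : A (D (j + 1) - D j) = R (j + 1) - R j := by
  rw [h.R_eq (j + 1) hj, h.R_eq j hj.le, map_sub]; abel

lemma R_mem (hL : L ≠ 0) {j : ℕ} (hj : j < k) : R j ∈ initialSpan X (j + 1) := by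
  have e : R j = L • D j - L • X j := by
    rw [h.X_eq j hj, smul_sub, smul_smul, mul_one_div_cancel hL, one_smul]; abel
  rw [e]
  exact Submodule.sub_mem _
    (Submodule.smul_mem _ _ (initialSpan_mono (Nat.le_succ j) (h.D_mem hj.le)))
    (Submodule.smul_mem _ _ (mem_initialSpan (Nat.lt_succ_self j)))

lemma R_ne_zero {j : ℕ} (hj : j < k) : R j ≠ 0 := by
  intro h0
  apply h.indep j hj
  rw [h.X_eq j hj, h0, smul_zero, sub_zero]
  exact h.D_mem hj.le

/-- The last mixing coefficient is at least one. -/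
lemma one_le_coeff (hL : 0 < L)
    (hpos : ∀ y, y ≠ 0 → 0 < ⟪y, A y⟫_ℝ) (hcoc : ∀ y, ‖A y‖ ^ 2 ≤ L * ⟪y, A y⟫_ℝ)
    {j : ℕ} (hj : j < k) : 1 ≤ a j := by
  set w := memoryTerm L R D a j with hw
  have hwmem := h.memoryTerm_mem hj
  rw [← hw] at hwmem
  have hAu : A w - (a j / L) • A (R j) = R (j + 1) - R j := by
    rw [← h.map_diff_eq hj, diff_eq_memoryTerm_sub j, map_sub, map_smul]
  have hRm := h.R_mem hL.ne' hj
  have hq : 0 < ⟪R j, A (R j)⟫_ℝ := hpos _ (h.R_ne_zero hj)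
  have h1 := h.inner_map_eq_zero (Nat.succ_le_of_lt hj) hRm
  -- `h2` and `h3` test `R (j + 1) - R j = A w - (a j / L) • A (R j)` against `A w` and `A (R j)`.
  have h2 : ⟪A w, A w⟫_ℝ = a j / L * ⟪A (R j), A w⟫_ℝ := by
    have e1 := h.inner_map_eq_zero (Nat.succ_le_of_lt hj)
      (initialSpan_mono (Nat.le_succ j) hwmem)
    have e2 := h.inner_map_eq_zero hj.le hwmem
    have e3 : ⟪A w - (a j / L) • A (R j), A w⟫_ℝ = 0 := by
      rw [hAu, inner_sub_left, e1, e2, sub_zero]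
    rw [inner_sub_left, real_inner_smul_left] at e3
    linarith
  have h3 : ⟪R j, A (R j)⟫_ℝ = a j / L * ‖A (R j)‖ ^ 2 - ⟪A w, A (R j)⟫_ℝ := by
    have e3 : ⟪A w - (a j / L) • A (R j), A (R j)⟫_ℝ = - ⟪R j, A (R j)⟫_ℝ := by
      rw [hAu, inner_sub_left, h1, zero_sub]
    rw [inner_sub_left, real_inner_smul_left, real_inner_self_eq_norm_sq] at e3
    linarith
  have h4 := real_inner_mul_inner_self_le (A w) (A (R j))
  rw [real_inner_comm (A w) (A (R j))] at h2
  rw [h2, real_inner_self_eq_norm_sq (A (R j))] at h4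
  -- With `s` this inner product, Cauchy–Schwarz reads `s ^ 2 ≤ a j / L * s * ‖A (R j)‖ ^ 2`, which
  -- by `h3` means `0 ≤ ⟪R j, A (R j)⟫ * s`. Dropping `s` from `h3` then leaves a bound to set
  -- against cocoercivity.
  have hs : 0 ≤ ⟪A w, A (R j)⟫_ℝ := by
    by_contra hneg
    push Not at hneg
    have h5 : 0 ≤ ⟪R j, A (R j)⟫_ℝ * ⟪A w, A (R j)⟫_ℝ := by rw [h3]; linarith
    exact absurd h5 (not_le.2 (mul_neg_of_pos_of_neg hq hneg))
  have h5 := hcoc (R j)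
  have hP : 0 < ‖A (R j)‖ ^ 2 := by
    refine pow_pos (norm_pos_iff.2 fun h0 => ?_) 2
    rw [h0, inner_zero_right] at hq
    exact hq.false
  have h6 : ‖A (R j)‖ ^ 2 ≤ a j * ‖A (R j)‖ ^ 2 := by
    calc ‖A (R j)‖ ^ 2 ≤ L * ⟪R j, A (R j)⟫_ℝ := h5
      _ ≤ L * (a j / L * ‖A (R j)‖ ^ 2) := by gcongr; linarith
      _ = a j * ‖A (R j)‖ ^ 2 := by field_simp
  nlinarith

/-- The search spaces behave like Krylov spaces: `A (D (i + 1))` is a difference of residuals, hence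
lies in the next span, and a nonzero last coefficient allows solving for `A (X i)`. -/
lemma map_mem_initialSpan (hL : L ≠ 0) (ha : ∀ j < k, a j ≠ 0) {i : ℕ} (hi : i + 1 < k) {y : E}
    (hy : y ∈ initialSpan X i) : A y ∈ initialSpan X (i + 1) := by
  induction i generalizing y with
  | zero => rw [eq_zero_of_mem_initialSpan_zero hy, map_zero]; exact Submodule.zero_mem _
  | succ i ih =>
    obtain ⟨c, y', hy', rfl⟩ := exists_of_mem_initialSpan_succ hy
    have hle : initialSpan X (i + 1) ≤ initialSpan X (i + 1 + 1) :=
      initialSpan_mono (Nat.le_succ (i + 1))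
    have hy'' := hle (ih (by omega) hy')
    have h1 := hle (ih (by omega) (h.D_succ i (by omega)))
    have h2 : A (D (i + 1)) ∈ initialSpan X (i + 1 + 1) := by
      have e : A (D (i + 1)) = R (i + 1) - R 0 := by rw [h.R_eq (i + 1) (by omega)]; abel
      rw [e]
      exact Submodule.sub_mem _ (h.R_mem hL (by omega))
        (initialSpan_mono (by omega) (h.R_mem hL (by omega)))
    have h3 : A (X i) ∈ initialSpan X (i + 1 + 1) := by
      have e : A (X i) = (a i)⁻¹ • (A (D (i + 1)) - A (D (i + 1) - a i • X i)) := by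
        rw [map_sub, map_smul, sub_sub_cancel, smul_smul, inv_mul_cancel₀ (ha i (by omega)),
          one_smul]
      rw [e]
      exact Submodule.smul_mem _ _ (Submodule.sub_mem _ h2 h1)
    rw [map_add, map_smul]
    exact Submodule.add_mem _ (Submodule.smul_mem _ _ h3) hy''

/-- The memory terms point against the residuals. -/
lemma inner_memoryTerm_nonpos (hL : 0 < L) (hsymm : ∀ y y', ⟪A y, y'⟫_ℝ = ⟪y, A y'⟫_ℝ)
    (hpos : ∀ y, y ≠ 0 → 0 < ⟪y, A y⟫_ℝ) (hcoc : ∀ y, ‖A y‖ ^ 2 ≤ L * ⟪y, A y⟫_ℝ)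
    {j : ℕ} (hj : j < k) : ⟪R j, memoryTerm L R D a j⟫_ℝ ≤ 0 := by
  have ha : ∀ j < k, 1 ≤ a j := fun j hj => h.one_le_coeff hL hpos hcoc hj
  have hker : ∀ y, A y = 0 → y = 0 := fun y hy => by
    by_contra hne
    have := hpos y hne
    rw [hy, inner_zero_right] at this
    exact this.false
  induction j with
  | zero =>
    rw [eq_zero_of_mem_initialSpan_zero (h.memoryTerm_mem hj), inner_zero_right]
  | succ j ih =>
    have ih := ih (by omega)
    set u := D (j + 1) - D j with hu
    set w := memoryTerm L R D a (j + 1) with hw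
    have hwmem : w ∈ initialSpan X (j + 1) := h.memoryTerm_mem hj
    have hAu : A u = R (j + 1) - R j := h.map_diff_eq (by omega)
    have hAu' : A w - (a (j + 1) / L) • A (R (j + 1)) = R (j + 2) - R (j + 1) := by
      rw [← h.map_diff_eq hj, diff_eq_memoryTerm_sub (j + 1), map_sub, map_smul]
    have humem : u ∈ initialSpan X (j + 1) := Submodule.sub_mem _ (h.D_mem (by omega))
      (initialSpan_mono (Nat.le_succ j) (h.D_mem (by omega)))
    have haj := ha j (by omega)
    have haj' := ha (j + 1) hj
    have hwA : ∀ y ∈ initialSpan X (j + 1),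
        ⟪A w, A y⟫_ℝ = a (j + 1) / L * ⟪A (R (j + 1)), A y⟫_ℝ := by
      intro y hy
      have e1 := h.inner_map_eq_zero (j := j + 2) hj (initialSpan_mono (by omega) hy)
      have e2 := h.inner_map_eq_zero (j := j + 1) (by omega) hy
      have e3 : ⟪A w - (a (j + 1) / L) • A (R (j + 1)), A y⟫_ℝ = 0 := by
        rw [hAu', inner_sub_left, e1, e2, sub_zero]
      rw [inner_sub_left, real_inner_smul_left] at e3
      linarith
    -- As `a j ≠ 0`, the last increment `u` can replace `X j` as the newest direction.
    obtain ⟨c, w', hw', hwe⟩ : ∃ (c : ℝ) (w' : E), w' ∈ initialSpan X j ∧ w = c • u + w' := by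
      obtain ⟨c, y', hy', e⟩ := exists_of_mem_initialSpan_succ hwmem
      have e1 : X j = (a j)⁻¹ • (u - ((D (j + 1) - a j • X j) - D j)) := by
        have : u - ((D (j + 1) - a j • X j) - D j) = a j • X j := by rw [hu]; abel
        rw [this, smul_smul, inv_mul_cancel₀ (by linarith), one_smul]
      refine ⟨c * (a j)⁻¹, y' - (c * (a j)⁻¹) • ((D (j + 1) - a j • X j) - D j), ?_, ?_⟩
      · exact Submodule.sub_mem _ hy' (Submodule.smul_mem _ _
          (Submodule.sub_mem _ (h.D_succ j (by omega)) (h.D_mem (by omega))))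
      · rw [e]
        nth_rewrite 1 [e1]
        module
    have hw'1 := initialSpan_mono (Nat.le_succ j) hw'
    -- Both `A w` and `A u` are orthogonal to `A w'`; for `A w`, symmetry produces `⟪R (j + 1), A (A
    -- w')⟫`, which vanishes because `A w'` is still a search vector. Only one direction of memory
    -- survives, as in conjugate residual methods.
    have hz : w' = 0 := by
      apply hker
      have h1 : ⟪A w, A w'⟫_ℝ = 0 := by
        rw [hwA w' hw'1, hsymm, h.inner_map_eq_zero (by omega), mul_zero]
        exact h.map_mem_initialSpan hL.ne' (fun i hi => by linarith [ha i hi]) (by omega) hw'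
      have h2 : ⟪A u, A w'⟫_ℝ = 0 := by
        rw [hAu, inner_sub_left, h.inner_map_eq_zero (by omega) hw'1,
          h.inner_map_eq_zero (by omega) hw', sub_zero]
      rw [hwe, map_add, map_smul, inner_add_left, real_inner_smul_left, h2, mul_zero,
        zero_add] at h1
      exact inner_self_eq_zero.1 h1
    rw [hz, add_zero] at hwe
    have hRu : ⟪R j, u⟫_ℝ ≤ 0 := by
      rw [hu, diff_eq_memoryTerm_sub j, inner_sub_right, inner_smul_right, real_inner_self_eq_norm_sq]
      have : 0 ≤ a j / L * ‖R j‖ ^ 2 := by positivity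
      linarith
    have hRu' : ⟪R (j + 1), u⟫_ℝ ≤ 0 := by
      have e := inner_mul_sq_eq (k := k) (fun i hi => h.D_mem hi.le) h.X_eq
        (fun i hi i' hi' => h.inner_R_R hi hi') (by omega) humem
      have hp : 0 < ‖R j‖ ^ 2 := pow_pos (norm_pos_iff.2 (h.R_ne_zero (by omega))) 2
      by_contra hneg
      push Not at hneg
      nlinarith [mul_pos hneg hp, mul_nonneg (sq_nonneg ‖R (j + 1)‖) (neg_nonneg.2 hRu)]
    by_cases hu0 : u = 0
    · rw [hwe, hu0, smul_zero, inner_zero_right]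
    -- Pairing with `A u` gives `c * ‖A u‖ ^ 2 = a (j + 1) / L * ⟪R (j + 1), A (R (j + 1))⟫`; the
    -- contribution of `R j` vanishes by orthogonality.
    have hc : 0 ≤ c := by
      have e := hwA u humem
      rw [hwe, map_smul, real_inner_smul_left, real_inner_self_eq_norm_sq, hAu, inner_sub_right,
        hsymm _ (R j), ← hAu, h.inner_map_eq_zero (by omega)
          (h.R_mem hL.ne' (by omega)), sub_zero, hsymm] at e
      have hq := hpos _ (h.R_ne_zero hj)
      have hp : 0 < ‖A u‖ ^ 2 := pow_pos (norm_pos_iff.2 fun h0 => hu0 (hker u h0)) 2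
      have : 0 ≤ a (j + 1) / L * ⟪R (j + 1), A (R (j + 1))⟫_ℝ := by positivity
      by_contra hneg
      push Not at hneg
      linarith [mul_neg_of_neg_of_pos hneg hp]
    rw [hwe, inner_smul_right]
    exact mul_nonpos_of_nonneg_of_nonpos hc hRu'

end IsLinearAA

end Krylov

/-! ### Nearly linear runs: bounded coefficients and passage to a linear limit. -/

section Asymptotic

open Asymptotics

variable {E : Type*} [NormedAddCommGroup E] [InnerProductSpace ℝ E]
  {ι : Type*} {F : Filter ι}

lemma isBigO_inner {u v : ι → E} {s s' : ι → ℝ} (hu : u =O[F] s) (hv : v =O[F] s') :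
    (fun l => ⟪u l, v l⟫_ℝ) =O[F] fun l => s l * s' l :=
  (IsBigO.of_norm_le fun l => by
    simpa using norm_inner_le_norm (𝕜 := ℝ) (u l) (v l)).trans (hu.norm_left.mul hv.norm_left)

/-- Compactness of balls; with an ultrafilter all rescaled quantities converge at once, without
successive subsequences. -/
lemma exists_tendsto_of_isBigO_one {E : Type*} [NormedAddCommGroup E] [ProperSpace E] {𝒰 : Ultrafilter ι} {u : ι → E}
    (hu : u =O[(𝒰 : Filter ι)] fun _ => (1 : ℝ)) : ∃ y, Tendsto u 𝒰 (𝓝 y) := by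
  obtain ⟨C, hC⟩ := hu.bound
  have hm : ∀ᶠ l in (𝒰 : Filter ι), u l ∈ Metric.closedBall (0 : E) C := by
    filter_upwards [hC] with l hl
    simpa using hl
  obtain ⟨y, -, hy⟩ := (isCompact_closedBall (0 : E) C).ultrafilter_le_nhds (𝒰.map u)
    (by rw [Ultrafilter.coe_map]; exact le_principal_iff.2 hm)
  exact ⟨y, hy⟩

/-- A family of runs of restarted Anderson acceleration of depth `k`, for gradient increments `Y`
that are nearly linear: `Y = A X + O(t²)`, where `t` is the size of the initial gradient `R 0`. -/
structure IsNearlyLinearAA (F : Filter ι) (A : E →L[ℝ] E) (L : ℝ) (k : ℕ) (t : ι → ℝ)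
    (X Y R D : ι → ℕ → E) (α : ι → ℕ → ℕ → ℝ) : Prop where
  t_pos : ∀ᶠ l in F, 0 < t l
  t_zero : Tendsto t F (𝓝 0)
  norm_R_zero : ∀ l, ‖R l 0‖ = t l
  D_eq : ∀ l, ∀ j ≤ k, D l j = ∑ i ∈ Finset.range j, α l j i • X l i
  R_eq : ∀ l, ∀ j ≤ k, R l j = R l 0 + ∑ i ∈ Finset.range j, α l j i • Y l i
  orth : ∀ l, ∀ j ≤ k, ∀ i < j, ⟪R l j, Y l i⟫_ℝ = 0
  X_eq : ∀ j < k, ∀ᶠ l in F, X l j = D l j - (1 / L) • R l j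
  X_isBigO : ∀ i < k, (fun l => X l i) =O[F] t
  Y_approx : ∀ i < k, (fun l => Y l i - A (X l i)) =O[F] fun l => t l ^ 2
  cond : ∃ c > 0, ∀ᶠ l in F, ∀ b : ℕ → ℝ, ∀ i < k,
    c * t l * |b i| ≤ ‖∑ i ∈ Finset.range k, b i • X l i‖

namespace IsNearlyLinearAA

variable {A : E →L[ℝ] E} {L : ℝ} {k : ℕ} {t : ι → ℝ} {X Y R D : ι → ℕ → E}
  {α : ι → ℕ → ℕ → ℝ} {μ : ℝ} (h : IsNearlyLinearAA F A L k t X Y R D α)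
include h

lemma inner_R_sub (l : ι) {j : ℕ} (hj : j ≤ k) {i : ℕ} (hi : i ≤ j) :
    ⟪R l j, R l i⟫_ℝ = ‖R l j‖ ^ 2 := by
  have key : ∀ i ≤ j, ⟪R l j, R l i - R l 0⟫_ℝ = 0 := by
    intro i hi
    rw [h.R_eq l i (by omega), add_sub_cancel_left, inner_sum]
    refine Finset.sum_eq_zero fun i' hi' => ?_
    rw [inner_smul_right, h.orth l j hj i' (by have := Finset.mem_range.1 hi'; omega), mul_zero]
  have h1 := key i hi
  have h2 := key j le_rfl
  rw [inner_sub_right] at h1 h2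
  rw [← real_inner_self_eq_norm_sq]
  linarith

lemma norm_R_le (l : ι) {j : ℕ} (hj : j ≤ k) : ‖R l j‖ ≤ t l := by
  have h1 := h.inner_R_sub l hj (Nat.zero_le j)
  have h2 := real_inner_le_norm (R l j) (R l 0)
  rw [h1, h.norm_R_zero] at h2
  rcases (norm_nonneg (R l j)).eq_or_lt with h0 | h0
  · rw [← h0, ← h.norm_R_zero]; exact norm_nonneg _
  · nlinarith

lemma R_isBigO {j : ℕ} (hj : j ≤ k) : (fun l => R l j) =O[F] t :=
  IsBigO.of_norm_le fun l => h.norm_R_le l hj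

/-- The conditioning bound for the first `j` increments. -/
lemma cond_initial : ∃ c > 0, ∀ᶠ l in F, ∀ j ≤ k, ∀ b : ℕ → ℝ, ∀ i < j,
    c * t l * |b i| ≤ ‖∑ i ∈ Finset.range j, b i • X l i‖ := by
  obtain ⟨c, hc, hcond⟩ := h.cond
  refine ⟨c, hc, ?_⟩
  filter_upwards [hcond] with l hl j hj b i hi
  have h1 := hl (fun i => if i < j then b i else 0) i (by omega)
  rw [if_pos hi] at h1
  have h2 : ∑ i ∈ Finset.range k, (if i < j then b i else 0) • X l i =
      ∑ i ∈ Finset.range j, b i • X l i := by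
    refine (Finset.sum_subset_zero_on_sdiff (Finset.range_mono hj) ?_ ?_).symm
    · intro i hi
      rw [Finset.mem_sdiff, Finset.mem_range, Finset.mem_range] at hi
      rw [if_neg hi.2, zero_smul]
    · intro i hi
      rw [if_pos (Finset.mem_range.1 hi)]
  rwa [h2] at h1

/-- The mixing coefficients stay bounded. -/
lemma coeff_isBigO (hμ : 0 < μ) (hA : ∀ y, μ * ‖y‖ ≤ ‖A y‖) {j : ℕ} (hj : j ≤ k) {i : ℕ}
    (hi : i < j) : (fun l => α l j i) =O[F] fun _ => (1 : ℝ) := by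
  obtain ⟨c, hc, hcond⟩ := h.cond_initial
  have hY : (fun l => ∑ i ∈ Finset.range j, ‖Y l i - A (X l i)‖) =O[F] fun l => t l ^ 2 :=
    IsBigO.fun_sum fun i hi =>
      (h.Y_approx i (by have := Finset.mem_range.1 hi; omega)).norm_left
  obtain ⟨C, hC⟩ := hY.bound
  have hj0 : (0 : ℝ) < j := by exact_mod_cast (Nat.zero_le i).trans_lt hi
  -- With `S` the sum of the `|α l j i|`, conditioning gives `c * t * S ≤ j * ‖D‖` and coercivity
  -- gives `μ * ‖D‖ ≤ 2 * t + S * |C| * t ^ 2`. For such small `t` the term with `S` on the right is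
  -- absorbed.
  have hsmall : ∀ᶠ l in F, |C| * t l < μ * c / (2 * j) := by
    have : Tendsto (fun l => |C| * t l) F (𝓝 (|C| * 0)) := h.t_zero.const_mul _
    rw [mul_zero] at this
    exact this.eventually (gt_mem_nhds (by positivity))
  refine IsBigO.of_bound (4 * j / (μ * c)) ?_
  filter_upwards [hC, hcond, hsmall, h.t_pos] with l hl hcl hsl htl
  set S := ∑ i ∈ Finset.range j, |α l j i| with hS
  have hS0 : 0 ≤ S := Finset.sum_nonneg fun _ _ => abs_nonneg _
  have h1 : c * t l * S ≤ j * ‖D l j‖ := by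
    rw [hS, Finset.mul_sum, h.D_eq l j hj]
    refine (Finset.sum_le_sum fun i hi => hcl j hj (α l j) i (Finset.mem_range.1 hi)).trans ?_
    simp
  have h2 : A (D l j) = (R l j - R l 0) - ∑ i ∈ Finset.range j, α l j i • (Y l i - A (X l i)) := by
    rw [h.R_eq l j hj, h.D_eq l j hj, map_sum]
    simp only [map_smul, smul_sub, Finset.sum_sub_distrib]
    abel
  have h3 : ‖∑ i ∈ Finset.range j, α l j i • (Y l i - A (X l i))‖ ≤ S * (|C| * t l ^ 2) := by
    rw [hS, Finset.sum_mul]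
    refine (norm_sum_le _ _).trans (Finset.sum_le_sum fun i hi => ?_)
    rw [norm_smul, Real.norm_eq_abs]
    refine mul_le_mul_of_nonneg_left ?_ (abs_nonneg _)
    have e := Finset.single_le_sum (f := fun i => ‖Y l i - A (X l i)‖)
      (fun _ _ => norm_nonneg _) hi
    have e2 : ‖∑ i ∈ Finset.range j, ‖Y l i - A (X l i)‖‖ ≤ |C| * t l ^ 2 := by
      refine hl.trans ?_
      rw [Real.norm_of_nonneg (sq_nonneg (t l))]
      gcongr
      exact le_abs_self C
    exact e.trans ((le_abs_self _).trans e2)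
  have h4 : μ * ‖D l j‖ ≤ 2 * t l + S * (|C| * t l ^ 2) := by
    refine (hA _).trans ?_
    rw [h2]
    refine (norm_sub_le _ _).trans (add_le_add ((norm_sub_le _ _).trans ?_) h3)
    linarith [h.norm_R_le l hj, (h.norm_R_zero l).le]
  have h5 : μ * c * S ≤ j * (2 + S * (|C| * t l)) := by
    have : t l * (μ * c * S) ≤ t l * (j * (2 + S * (|C| * t l))) := by
      calc t l * (μ * c * S) = μ * (c * t l * S) := by ring
        _ ≤ μ * (j * ‖D l j‖) := by gcongr
        _ = j * (μ * ‖D l j‖) := by ring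
        _ ≤ j * (2 * t l + S * (|C| * t l ^ 2)) := by gcongr
        _ = _ := by ring
    exact le_of_mul_le_mul_left this htl
  have h6 : j * (|C| * t l) ≤ μ * c / 2 := by
    calc j * (|C| * t l) ≤ j * (μ * c / (2 * j)) := by gcongr
      _ = μ * c / 2 := by field_simp
  have h7 : |α l j i| ≤ S := Finset.single_le_sum (f := fun i => |α l j i|)
    (fun _ _ => abs_nonneg _) (Finset.mem_range.2 hi)
  rw [norm_one, mul_one, Real.norm_eq_abs, le_div_iff₀ (by positivity)]
  nlinarith [mul_le_mul_of_nonneg_left h6 hS0, mul_le_mul_of_nonneg_left h7 (mul_pos hμ hc).le]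

lemma D_isBigO (hμ : 0 < μ) (hA : ∀ y, μ * ‖y‖ ≤ ‖A y‖) {j : ℕ} (hj : j ≤ k) :
    (fun l => D l j) =O[F] t := by
  have : (fun l => ∑ i ∈ Finset.range j, α l j i • X l i) =O[F] t := by
    refine IsBigO.fun_sum fun i hi => ?_
    have hi := Finset.mem_range.1 hi
    simpa using (h.coeff_isBigO hμ hA hj hi).smul (h.X_isBigO i (by omega))
  exact this.congr_left fun l => (h.D_eq l j hj).symm

/-- `X j - D j = -R j / L` is a combination of increments with coefficient one at `X j`, so
conditioning bounds it below. -/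
lemma norm_R_ge (hL : 0 < L) {j : ℕ} (hj : j < k) : ∃ c > 0, ∀ᶠ l in F, c * t l ≤ ‖R l j‖ := by
  obtain ⟨c, hc, hcond⟩ := h.cond_initial
  refine ⟨c * L, by positivity, ?_⟩
  filter_upwards [hcond, h.X_eq j hj] with l hl hX
  have h1 := hl (j + 1) hj (Function.update (-(α l j)) j 1) j (Nat.lt_succ_self j)
  have h2 : ∑ i ∈ Finset.range (j + 1), Function.update (-(α l j)) j 1 i • X l i =
      -((1 / L) • R l j) := by
    rw [Finset.sum_range_succ, Function.update_self, one_smul]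
    have : ∑ i ∈ Finset.range j, Function.update (-(α l j)) j 1 i • X l i = - D l j := by
      rw [h.D_eq l j hj.le, ← Finset.sum_neg_distrib]
      refine Finset.sum_congr rfl fun i hi => ?_
      rw [Function.update_of_ne (Finset.mem_range.1 hi).ne, Pi.neg_apply, neg_smul]
    rw [this, hX]; abel
  rw [h2, Function.update_self, abs_one, mul_one, norm_neg, norm_smul,
    Real.norm_of_nonneg (by positivity), one_div, inv_mul_eq_div, le_div_iff₀ hL] at h1
  linarith

/-- Along an ultrafilter the rescaled runs converge to a run for the linear map `A`. -/
lemma exists_limit [ProperSpace E] {𝒰 : Ultrafilter ι} (h𝒰 : (𝒰 : Filter ι) ≤ F)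
    (hμ : 0 < μ) (hA : ∀ y, μ * ‖y‖ ≤ ‖A y‖) :
    ∃ (X' R' D' : ℕ → E) (a : ℕ → ℝ), IsLinearAA A L k X' R' D' a ∧
      (∀ j ≤ k, Tendsto (fun l => (t l)⁻¹ • R l j) 𝒰 (𝓝 (R' j))) ∧
      (∀ j ≤ k, Tendsto (fun l => (t l)⁻¹ • D l j) 𝒰 (𝓝 (D' j))) ∧
      ∀ j < k, Tendsto (fun l => α l (j + 1) j) 𝒰 (𝓝 (a j)) := by
  have hne : ∀ᶠ l in (𝒰 : Filter ι), t l ≠ 0 := (h.t_pos.filter_mono h𝒰).mono fun l hl => hl.ne'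
  have hscale : ∀ {u : ι → E}, u =O[F] t →
      (fun l => (t l)⁻¹ • u l) =O[(𝒰 : Filter ι)] fun _ => (1 : ℝ) := by
    intro u hu
    refine ((isBigO_refl (fun l => (t l)⁻¹) (𝒰 : Filter ι)).smul (hu.mono h𝒰)).trans_eventuallyEq ?_
    filter_upwards [hne] with l hl
    simp [hl]
  have hX : ∀ i, ∃ y, i < k → Tendsto (fun l => (t l)⁻¹ • X l i) 𝒰 (𝓝 y) := by
    intro i
    by_cases hi : i < k
    · obtain ⟨y, hy⟩ := exists_tendsto_of_isBigO_one (hscale (h.X_isBigO i hi))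
      exact ⟨y, fun _ => hy⟩
    · exact ⟨0, fun h => absurd h hi⟩
  have hα : ∀ j i, ∃ y, j ≤ k → i < j → Tendsto (fun l => α l j i) 𝒰 (𝓝 y) := by
    intro j i
    by_cases hj : j ≤ k
    · by_cases hi : i < j
      · obtain ⟨y, hy⟩ := exists_tendsto_of_isBigO_one ((h.coeff_isBigO hμ hA hj hi).mono h𝒰)
        exact ⟨y, fun _ _ => hy⟩
      · exact ⟨0, fun _ h => absurd h hi⟩
    · exact ⟨0, fun h => absurd h hj⟩
  choose X' hX' using hX
  choose α' hα' using hα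
  obtain ⟨R0, hR0⟩ := exists_tendsto_of_isBigO_one (hscale (h.R_isBigO (Nat.zero_le k)))
  have hY' : ∀ i < k, Tendsto (fun l => (t l)⁻¹ • Y l i) 𝒰 (𝓝 (A (X' i))) := by
    intro i hi
    have h1 : Tendsto (fun l => (t l)⁻¹ • (Y l i - A (X l i))) 𝒰 (𝓝 0) := by
      have : (fun l => (t l)⁻¹ • (Y l i - A (X l i))) =O[(𝒰 : Filter ι)] t := by
        refine ((isBigO_refl (fun l => (t l)⁻¹) (𝒰 : Filter ι)).smul
          ((h.Y_approx i hi).mono h𝒰)).trans_eventuallyEq ?_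
        filter_upwards [hne] with l hl
        simp only [smul_eq_mul]
        field_simp
      exact this.trans_tendsto (h.t_zero.mono_left h𝒰)
    have h2 := (A.continuous.tendsto _).comp (hX' i hi)
    refine ((h1.add h2).congr fun l => ?_).trans (by rw [zero_add])
    simp [smul_sub]
  let D' : ℕ → E := fun j => ∑ i ∈ Finset.range j, α' j i • X' i
  have hD' : ∀ j ≤ k, Tendsto (fun l => (t l)⁻¹ • D l j) 𝒰 (𝓝 (D' j)) := by
    intro j hj
    have : Tendsto (fun l => ∑ i ∈ Finset.range j, α l j i • (t l)⁻¹ • X l i) 𝒰 (𝓝 (D' j)) := by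
      refine tendsto_finsetSum _ fun i hi => ?_
      have hi := Finset.mem_range.1 hi
      exact (hα' j i hj hi).smul (hX' i (by omega))
    refine this.congr fun l => ?_
    rw [h.D_eq l j hj, Finset.smul_sum]
    exact Finset.sum_congr rfl fun i _ => smul_comm _ _ _
  let R' : ℕ → E := fun j => R0 + A (D' j)
  have hR' : ∀ j ≤ k, Tendsto (fun l => (t l)⁻¹ • R l j) 𝒰 (𝓝 (R' j)) := by
    intro j hj
    have : Tendsto (fun l => (t l)⁻¹ • R l 0 + ∑ i ∈ Finset.range j, α l j i • (t l)⁻¹ • Y l i) 𝒰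
        (𝓝 (R' j)) := by
      refine hR0.add ?_
      simp only [D', map_sum, map_smul]
      refine tendsto_finsetSum _ fun i hi => ?_
      have hi := Finset.mem_range.1 hi
      exact (hα' j i hj hi).smul (hY' i (by omega))
    refine this.congr fun l => ?_
    rw [h.R_eq l j hj, smul_add, Finset.smul_sum]
    exact congrArg _ (Finset.sum_congr rfl fun i _ => smul_comm _ _ _)
  have hR0' : R' 0 = R0 := by simp [R', D']
  refine ⟨X', R', D', fun j => α' (j + 1) j, ⟨by simp [D'], fun j hj => ?_, fun j hj => ?_,
    fun j hj i hi => ?_, fun j hj => ?_, fun j hj hmem => ?_⟩, hR', hD',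
    fun j hj => hα' (j + 1) j hj (Nat.lt_succ_self j)⟩
  · simp only [D', Finset.sum_range_succ, add_sub_cancel_right]
    exact sum_mem_initialSpan _ _
  · rw [hR0']
  · refine tendsto_nhds_unique ((hR' j hj).inner (hY' i (by omega))) ?_
    refine tendsto_const_nhds.congr fun l => ?_
    rw [inner_smul_right, real_inner_smul_left, h.orth l j hj i hi]
    simp
  · refine tendsto_nhds_unique (hX' j hj)
      (((hD' j hj.le).sub ((hR' j hj.le).const_smul (1 / L))).congr' ?_)
    filter_upwards [(h.X_eq j hj).filter_mono h𝒰] with l hl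
    rw [hl, smul_sub, smul_comm (1 / L)]
  · obtain ⟨b, hb⟩ := exists_sum_of_mem_initialSpan hmem
    obtain ⟨c, hc, hcond⟩ := h.cond_initial
    let b' := Function.update (-b) j 1
    have hlim : Tendsto (fun l => ‖∑ i ∈ Finset.range (j + 1), b' i • (t l)⁻¹ • X l i‖) 𝒰
        (𝓝 ‖∑ i ∈ Finset.range (j + 1), b' i • X' i‖) := by
      refine (tendsto_finsetSum _ fun i hi => ?_).norm
      have hi := Finset.mem_range.1 hi
      exact (hX' i (by omega)).const_smul _
    have hz : ∑ i ∈ Finset.range (j + 1), b' i • X' i = 0 := by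
      have e : ∑ i ∈ Finset.range j, b' i • X' i = - ∑ i ∈ Finset.range j, b i • X' i := by
        rw [← Finset.sum_neg_distrib]
        refine Finset.sum_congr rfl fun i hi => ?_
        simp only [b']
        rw [Function.update_of_ne (Finset.mem_range.1 hi).ne, Pi.neg_apply, neg_smul]
      rw [Finset.sum_range_succ, e, ← hb]
      simp [b']
    rw [hz, norm_zero] at hlim
    refine absurd (ge_of_tendsto hlim (b := c) ?_) (not_le.2 hc)
    filter_upwards [hcond.filter_mono h𝒰, h.t_pos.filter_mono h𝒰] with l hl htl
    have h1 := hl (j + 1) hj b' j (Nat.lt_succ_self j)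
    have h2 : b' j = 1 := Function.update_self ..
    rw [h2, abs_one, mul_one] at h1
    have e : ∑ i ∈ Finset.range (j + 1), b' i • (t l)⁻¹ • X l i =
        (t l)⁻¹ • ∑ i ∈ Finset.range (j + 1), b' i • X l i := by
      rw [Finset.smul_sum]
      exact Finset.sum_congr rfl fun i _ => smul_comm _ _ _
    rw [e, norm_smul, Real.norm_of_nonneg (by positivity), inv_mul_eq_div, le_div_iff₀ htl]
    exact h1

/-- Up to vanishing errors, the last mixing coefficients are at least one and the memory terms point
against the residuals. -/
lemma eventually_coeff_and_memoryTerm [ProperSpace E] (hL : 0 < L)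
    (hsymm : ∀ y y', ⟪A y, y'⟫_ℝ = ⟪y, A y'⟫_ℝ)
    (hpos : ∀ y, y ≠ 0 → 0 < ⟪y, A y⟫_ℝ) (hcoc : ∀ y, ‖A y‖ ^ 2 ≤ L * ⟪y, A y⟫_ℝ)
    (hμ : 0 < μ) (hA : ∀ y, μ * ‖y‖ ≤ ‖A y‖) {j : ℕ} (hj : j < k) {ε : ℝ} (hε : 0 < ε) :
    ∀ᶠ l in F, 1 - ε ≤ α l (j + 1) j ∧
      ⟪R l j, memoryTerm L (R l) (D l) (fun j => α l (j + 1) j) j⟫_ℝ ≤ ε * t l ^ 2 := by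
  -- A frequent failure is carried by an ultrafilter finer than `F`, along which the limit run would
  -- violate the linear case.
  by_contra hcon
  rw [Filter.not_eventually, frequently_iff_neBot] at hcon
  obtain ⟨𝒰, h𝒰⟩ := @Ultrafilter.exists_le _ _ hcon
  obtain ⟨hF, hnot⟩ := le_inf_iff.1 h𝒰
  rw [le_principal_iff] at hnot
  obtain ⟨X', R', D', a, hlin, hR, hD, ha⟩ := h.exists_limit hF hμ hA
  have h1 : ∀ᶠ l in (𝒰 : Filter ι), 1 - ε ≤ α l (j + 1) j :=
    ((ha j hj).eventually (lt_mem_nhds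
      (by linarith [hlin.one_le_coeff hL hpos hcoc hj] : 1 - ε < a j))).mono fun _ h => h.le
  have hw : Tendsto (fun l => (t l)⁻¹ • memoryTerm L (R l) (D l) (fun j => α l (j + 1) j) j) 𝒰
      (𝓝 (memoryTerm L R' D' a j)) := by
    refine (((hD (j + 1) hj).sub (hD j hj.le)).add
      (((ha j hj).div_const L).smul (hR j hj.le))).congr fun l => ?_
    rw [memoryTerm, smul_add, smul_sub, smul_comm (t l)⁻¹ (_ / L)]
  have h2 : ∀ᶠ l in (𝒰 : Filter ι), ⟪(t l)⁻¹ • R l j,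
      (t l)⁻¹ • memoryTerm L (R l) (D l) (fun j => α l (j + 1) j) j⟫_ℝ < ε :=
    ((hR j hj.le).inner hw).eventually (gt_mem_nhds
      (lt_of_le_of_lt (hlin.inner_memoryTerm_nonpos hL hsymm hpos hcoc hj) hε))
  have h3 : ∀ᶠ l in (𝒰 : Filter ι), False := by
    filter_upwards [h1, h2, hnot, h.t_pos.filter_mono hF] with l hl1 hl2 hl3 htl
    refine hl3 ⟨hl1, ?_⟩
    rw [inner_smul_right, real_inner_smul_left, ← mul_assoc, ← mul_inv, ← sq, inv_mul_eq_div,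
      div_lt_iff₀ (by positivity)] at hl2
    exact hl2.le
  exact h3.exists.elim fun _ h => h

end IsNearlyLinearAA

end Asymptotic

/-! ### Approximate conjugacy and the gain of the accelerated step. -/

section Asymptotic

open Asymptotics

variable {E : Type*} [NormedAddCommGroup E] [InnerProductSpace ℝ E]
  {ι : Type*} {F : Filter ι}

namespace IsNearlyLinearAA

variable {A : E →L[ℝ] E} {L : ℝ} {k : ℕ} {t : ι → ℝ} {X Y R D : ι → ℕ → E}
  {α : ι → ℕ → ℕ → ℝ} {μ : ℝ} (h : IsNearlyLinearAA F A L k t X Y R D α)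
include h

lemma inner_R_map_X_isBigO {i : ℕ} (hi : i < k) :
    (fun l => ⟪R l k, A (X l i)⟫_ℝ) =O[F] fun l => t l ^ 3 := by
  have h1 := (isBigO_inner (h.R_isBigO le_rfl) (h.Y_approx i hi)).neg_left
  refine h1.congr (fun l => ?_) (fun l => by ring)
  rw [inner_sub_right, h.orth l k le_rfl i hi]
  ring

section Conjugacy

variable (hL : 0 < L) (hsymm : ∀ y y', ⟪A y, y'⟫_ℝ = ⟪y, A y'⟫_ℝ)
  (hμ : 0 < μ) (hA : ∀ y, μ * ‖y‖ ≤ ‖A y‖)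
include hL hsymm hμ hA

/-- `R i` equals `L • (D i - X i)`, a bounded combination of increments, and `A` of each increment
is nearly orthogonal to `R k`. -/
lemma inner_map_R_R_isBigO {i : ℕ} (hi : i < k) :
    (fun l => ⟪A (R l k), R l i⟫_ℝ) =O[F] fun l => t l ^ 3 := by
  have h1 : (fun l => ∑ i' ∈ Finset.range i, α l i i' * ⟪R l k, A (X l i')⟫_ℝ)
      =O[F] fun l => t l ^ 3 := by
    refine IsBigO.fun_sum fun i' hi' => ?_
    have hi' := Finset.mem_range.1 hi'
    simpa using (h.coeff_isBigO hμ hA hi.le hi').mul (h.inner_R_map_X_isBigO (hi'.trans hi))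
  have h2 := (h1.sub (h.inner_R_map_X_isBigO hi)).const_mul_left L
  refine h2.congr' ?_ EventuallyEq.rfl
  filter_upwards [h.X_eq i hi] with l hl
  have e : R l i = L • (D l i - X l i) := by
    rw [hl, sub_sub_cancel, smul_smul, mul_one_div_cancel hL.ne', one_smul]
  rw [e, inner_smul_right, inner_sub_right, hsymm, hsymm, h.D_eq l i hi.le, map_sum, inner_sum]
  simp only [map_smul, inner_smul_right]

/-- The expansion of `R (i + 1)` is solved for `Y i`; dividing by its last coefficient is harmless
because that stays above `1 / 2`. -/
lemma inner_map_R_Y_isBigO (hα : ∀ j < k, ∀ᶠ l in F, 1 / 2 ≤ α l (j + 1) j) {i : ℕ}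
    (hi : i + 1 < k) : (fun l => ⟪A (R l k), Y l i⟫_ℝ) =O[F] fun l => t l ^ 3 := by
  induction i using Nat.strong_induction_on with
  | _ i ih =>
    have h1 : (fun l => ∑ i' ∈ Finset.range i, α l (i + 1) i' * ⟪A (R l k), Y l i'⟫_ℝ)
        =O[F] fun l => t l ^ 3 := by
      refine IsBigO.fun_sum fun i' hi' => ?_
      have hi' := Finset.mem_range.1 hi'
      simpa using (h.coeff_isBigO hμ hA hi.le (by omega : i' < i + 1)).mul
        (ih i' hi' (by omega))
    have hinv : (fun l => (α l (i + 1) i)⁻¹) =O[F] fun _ => (1 : ℝ) := by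
      refine IsBigO.of_bound 2 ?_
      filter_upwards [hα i (by omega)] with l hl
      rw [norm_one, mul_one, norm_inv, Real.norm_of_nonneg (by linarith)]
      exact (inv_anti₀ (by norm_num) hl).trans (by norm_num)
    have h2 := hinv.mul (((h.inner_map_R_R_isBigO hL hsymm hμ hA hi).sub
      (h.inner_map_R_R_isBigO hL hsymm hμ hA (by omega : 0 < k))).sub h1)
    simp only [one_mul] at h2
    refine h2.congr' ?_ EventuallyEq.rfl
    filter_upwards [hα i (by omega)] with l hl
    have e := congrArg (fun y => ⟪A (R l k), y⟫_ℝ) (h.R_eq l (i + 1) hi.le)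
    simp only [inner_add_right, inner_sum, inner_smul_right, Finset.sum_range_succ] at e
    rw [inv_mul_eq_iff_eq_mul₀ (by linarith), e]
    ring

end Conjugacy

/-- The quadratic form measuring the gain of the accelerated step over the gradient step is
nonnegative up to higher order terms. -/
lemma gain_lower_bound [ProperSpace E] {p : ℕ} (hk : k = p + 1) (hL : 0 < L)
    (hsymm : ∀ y y', ⟪A y, y'⟫_ℝ = ⟪y, A y'⟫_ℝ)
    (hpos : ∀ y, y ≠ 0 → 0 < ⟪y, A y⟫_ℝ) (hcoc : ∀ y, ‖A y‖ ^ 2 ≤ L * ⟪y, A y⟫_ℝ)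
    (hub : ∀ y, ⟪y, A y⟫_ℝ ≤ L * ‖y‖ ^ 2)
    (hμ : 0 < μ) (hA : ∀ y, μ * ‖y‖ ≤ ‖A y‖) :
    ∃ C, ∀ ε > 0, ∀ᶠ l in F, -(ε * ‖R l k‖ ^ 2) - C * t l ^ 3 ≤
      ⟪R l k, X l p - D l k⟫_ℝ +
        1 / L ^ 2 * ⟪A (R l k), R l 0 + Y l p - R l k⟫_ℝ := by
  have hcm := fun j (hj : j < k) ε (hε : (0 : ℝ) < ε) =>
    h.eventually_coeff_and_memoryTerm hL hsymm hpos hcoc hμ hA hj hε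
  have hhalf : ∀ j < k, ∀ᶠ l in F, 1 / 2 ≤ α l (j + 1) j := fun j hj =>
    (hcm j hj (1 / 2) (by norm_num)).mono fun l hl => by linarith [hl.1]
  have hsum : (fun l => ∑ i ∈ Finset.range p, α l k i * ⟪A (R l k), Y l i⟫_ℝ)
      =O[F] fun l => t l ^ 3 := by
    refine IsBigO.fun_sum fun i hi => ?_
    have hi := Finset.mem_range.1 hi
    simpa using (h.coeff_isBigO hμ hA le_rfl (by omega : i < k)).mul
      (h.inner_map_R_Y_isBigO hL hsymm hμ hA hhalf (by omega : i + 1 < k))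
  have hcoeff : (fun l => α l k p - 1) =O[F] fun _ => (1 : ℝ) :=
    (h.coeff_isBigO hμ hA le_rfl (by omega : p < k)).sub (isBigO_refl _ _)
  have herr := (hcoeff.mul (h.inner_map_R_R_isBigO hL hsymm hμ hA (by omega : 0 < k))).sub
    (hsum.congr_right fun l => (one_mul _).symm)
  simp only [one_mul] at herr
  obtain ⟨C, hC⟩ := herr.bound
  obtain ⟨c, hc, hRc⟩ := h.norm_R_ge hL (by omega : p < k)
  -- The factor `2` comes from dividing by the last coefficient, at least `1 / 2`.
  refine ⟨2 * |C| / L ^ 2, fun ε hε => ?_⟩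
  -- The first tolerance bounds the defect of the coefficient below one; the second absorbs the `c ^
  -- 2` in the lower bound for `‖R l p‖ ^ 2`. Each costs half of `ε`.
  have hε1 : 0 < min (ε * L / 2) (ε / 2 * c ^ 2) := by positivity
  filter_upwards [hC, hRc, hcm p (by omega) _ hε1, hhalf p (by omega),
    (eventually_all_finite (Set.finite_Iio k)).2 h.X_eq, h.t_pos] with l hCl hcl ⟨hal, hwl⟩ hhl hXall htl
  have hXl := hXall p (by simp [hk])
  subst hk
  set k := p + 1
  set a := α l k p
  set w := memoryTerm L (R l) (D l) (fun j => α l (j + 1) j) p with hw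
  have ha0 : 0 < a := by linarith
  have hal' : 1 - ε * L / 2 ≤ a := by linarith [min_le_left (ε * L / 2) (ε / 2 * c ^ 2)]
  have hwl' : ⟪R l p, w⟫_ℝ ≤ ε / 2 * c ^ 2 * t l ^ 2 :=
    hwl.trans (mul_le_mul_of_nonneg_right (min_le_right _ _) (sq_nonneg _))
  -- The limit bounds `⟪R l p, w⟫` only by a small multiple of `t ^ 2`. Since `‖R l p‖` is at least
  -- `c * t`, the exact proportionality turns this into a bound by `‖R l k‖ ^ 2`.
  have hRw : ⟪R l k, w⟫_ℝ ≤ ε / 2 * ‖R l k‖ ^ 2 := by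
    have hwmem : w ∈ initialSpan (X l) (p + 1) := by
      have e : w = ∑ i ∈ Finset.range (p + 1), α l (p + 1) i • X l i +
          (a • D l p - D l p) - a • X l p := by
        rw [hw, memoryTerm, hXl, h.D_eq l (p + 1) le_rfl]; module
      rw [e]
      have hDm : D l p ∈ initialSpan (X l) (p + 1) := by
        rw [h.D_eq l p (Nat.le_succ p)]
        exact initialSpan_mono (Nat.le_succ p) (sum_mem_initialSpan _ _)
      exact Submodule.sub_mem _ (Submodule.add_mem _ (sum_mem_initialSpan _ _)
        (Submodule.sub_mem _ (Submodule.smul_mem _ _ hDm) hDm))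
        (Submodule.smul_mem _ _ (mem_initialSpan (Nat.lt_succ_self p)))
    have e := inner_mul_sq_eq (k := k) (X := X l) (R := R l) (D := D l)
      (fun j hj => by rw [h.D_eq l j hj.le]; exact sum_mem_initialSpan _ _) hXall
      (fun j hj i hi => h.inner_R_sub l hj hi) le_rfl hwmem
    rcases le_or_gt ⟪R l k, w⟫_ℝ 0 with h0 | h0
    · exact h0.trans (by positivity)
    have hct : 0 < c ^ 2 * t l ^ 2 := by positivity
    have hsq : c ^ 2 * t l ^ 2 ≤ ‖R l p‖ ^ 2 := by
      rw [← mul_pow]; exact pow_le_pow_left₀ (by positivity) hcl 2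
    refine le_of_mul_le_mul_right ?_ hct
    calc ⟪R l k, w⟫_ℝ * (c ^ 2 * t l ^ 2) ≤ ⟪R l k, w⟫_ℝ * ‖R l p‖ ^ 2 := by gcongr
      _ = ‖R l k‖ ^ 2 * ⟪R l p, w⟫_ℝ := e
      _ ≤ ‖R l k‖ ^ 2 * (ε / 2 * c ^ 2 * t l ^ 2) := by gcongr
      _ = ε / 2 * ‖R l k‖ ^ 2 * (c ^ 2 * t l ^ 2) := by ring
  have h1 : ⟪R l k, X l p - D l k⟫_ℝ = (a - 1) / L * ‖R l k‖ ^ 2 - ⟪R l k, w⟫_ℝ := by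
    have e : X l p - D l k = ((a - 1) / L) • R l p - w := by
      rw [hw, memoryTerm, hXl]; module
    rw [e, inner_sub_right, inner_smul_right, h.inner_R_sub l le_rfl (Nat.le_succ p)]
  -- `Y l p` is eliminated through the expansion of `R l k`; every remaining pairing in the last
  -- bracket is of order `t ^ 3` by conjugacy.
  have h2 : a * ⟪A (R l k), R l 0 + Y l p - R l k⟫_ℝ = (1 - a) * ⟪R l k, A (R l k)⟫_ℝ +
      ((a - 1) * ⟪A (R l k), R l 0⟫_ℝ -
        ∑ i ∈ Finset.range p, α l k i * ⟪A (R l k), Y l i⟫_ℝ) := by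
    have e := congrArg (fun y => ⟪A (R l k), y⟫_ℝ) (h.R_eq l k le_rfl)
    simp only [k, inner_add_right, inner_sum, inner_smul_right, Finset.sum_range_succ] at e
    rw [inner_sub_right, inner_add_right, real_inner_comm (A (R l k)) (R l k)]
    simp only [k, a]
    linarith
  set B := ⟪A (R l k), R l 0 + Y l p - R l k⟫_ℝ
  set e := (a - 1) * ⟪A (R l k), R l 0⟫_ℝ -
        ∑ i ∈ Finset.range p, α l k i * ⟪A (R l k), Y l i⟫_ℝ
  have he : -(|C| * t l ^ 3) ≤ e := by
    have : |e| ≤ |C| * t l ^ 3 := by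
      refine hCl.trans ?_
      rw [Real.norm_of_nonneg (by positivity)]
      gcongr
      exact le_abs_self C
    linarith [neg_abs_le e]
  have hq0 : 0 ≤ ⟪R l k, A (R l k)⟫_ℝ := by
    by_cases h0 : R l k = 0
    · rw [h0, inner_zero_left]
    · exact (hpos _ h0).le
  have hq := hub (R l k)
  set q := ⟪R l k, A (R l k)⟫_ℝ
  have hN := sq_nonneg ‖R l k‖
  set N := ‖R l k‖ ^ 2
  have hT : 0 ≤ |C| * t l ^ 3 := by positivity
  -- If `1 ≤ a`, then `(a - 1) / a ≤ a - 1`; otherwise the defect `1 - a` is at most `ε * L / 2`.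
  -- Divided by `L ^ 2`, the leading term cancels the one in `h1`.
  have hB : -(a - 1) * L * N - ε / 2 * L ^ 2 * N - 2 * (|C| * t l ^ 3) ≤ B := by
    refine le_of_mul_le_mul_left ?_ ha0
    rw [h2]
    have hLN : 0 ≤ L * N := by positivity
    have h3 : |C| * t l ^ 3 ≤ a * (2 * (|C| * t l ^ 3)) := by nlinarith
    have h4 : 0 ≤ a * (ε / 2 * L ^ 2 * N) := by positivity
    rcases le_or_gt 1 a with h1a | h1a
    · have h5 : (a - 1) * q ≤ (a - 1) * (L * N) := by gcongr
      have h6 : (a - 1) * (L * N) ≤ a * ((a - 1) * (L * N)) := by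
        nlinarith [mul_nonneg (sub_nonneg.2 h1a) hLN]
      linarith
    · have h5 : 0 ≤ (1 - a) * q := mul_nonneg (by linarith) hq0
      have h6 : (1 - a) * (L * N) ≤ ε * L / 2 * (L * N) := by gcongr; linarith
      have h7 := mul_le_mul_of_nonneg_left h6 ha0.le
      linarith
  have hB' : 1 / L ^ 2 * (-(a - 1) * L * N - ε / 2 * L ^ 2 * N - 2 * (|C| * t l ^ 3)) ≤
      1 / L ^ 2 * B := by gcongr
  have e1 : 1 / L ^ 2 * (-(a - 1) * L * N - ε / 2 * L ^ 2 * N - 2 * (|C| * t l ^ 3)) =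
      -((a - 1) / L * N) - ε / 2 * N - 2 * |C| / L ^ 2 * t l ^ 3 := by
    field_simp
  rw [h1]
  linarith

end IsNearlyLinearAA

end Asymptotic

/-! ### Strong convexity and spectral bounds for the Hessian. -/

section Hessian

variable {n : ℕ} {f : EuclideanSpace ℝ (Fin n) → ℝ} {L LH μ r : ℝ}
  {xstar : EuclideanSpace ℝ (Fin n)}

lemma strongConvex_gradient_le (hf : Differentiable ℝ f) {s : Set (EuclideanSpace ℝ (Fin n))}
    (hsc : StrongConvexOn s μ f) {x y : EuclideanSpace ℝ (Fin n)} (hx : x ∈ s) (hy : y ∈ s) :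
    f x + ⟪gradient f x, y - x⟫_ℝ + μ / 2 * ‖y - x‖ ^ 2 ≤ f y := by
  have hd := hasDerivAt_line hf x (y - x) 0
  rw [hasDerivAt_iff_tendsto_slope_zero] at hd
  simp only [zero_smul, add_zero, zero_add, smul_eq_mul] at hd
  have hd' := hd.mono_left (nhdsWithin_mono (0 : ℝ) (fun a (ha : a ∈ Set.Ioi 0) => ne_of_gt ha))
  have hr : Tendsto (fun a : ℝ => f y - f x - (1 - a) * (μ / 2 * ‖y - x‖ ^ 2)) (𝓝[>] 0)
      (𝓝 (f y - f x - (1 - 0) * (μ / 2 * ‖y - x‖ ^ 2))) := by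
    refine tendsto_nhdsWithin_of_tendsto_nhds (Continuous.tendsto ?_ 0)
    fun_prop
  have hle := le_of_tendsto_of_tendsto hd' hr ?_
  · linarith
  · filter_upwards [Ioo_mem_nhdsGT (zero_lt_one' ℝ)] with a ha
    have h := hsc.2 hx hy (by linarith [ha.2] : (0 : ℝ) ≤ 1 - a) ha.1.le (by ring)
    have e : (1 - a) • x + a • y = x + a • (y - x) := by module
    rw [e, norm_sub_rev x y, smul_eq_mul, smul_eq_mul] at h
    rw [inv_mul_le_iff₀ ha.1]
    linarith

lemma strongConvex_gradient_monotone (hf : Differentiable ℝ f)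
    {s : Set (EuclideanSpace ℝ (Fin n))}
    (hsc : StrongConvexOn s μ f) {x y : EuclideanSpace ℝ (Fin n)} (hx : x ∈ s) (hy : y ∈ s) :
    μ * ‖y - x‖ ^ 2 ≤ ⟪gradient f y - gradient f x, y - x⟫_ℝ := by
  have h1 := strongConvex_gradient_le hf hsc hx hy
  have h2 := strongConvex_gradient_le hf hsc hy hx
  rw [← neg_sub y x, inner_neg_right, norm_neg] at h2
  rw [inner_sub_left]
  linarith

lemma hessian_symm (hf : Differentiable ℝ f) (hd : DifferentiableAt ℝ (gradient f) xstar)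
    (y y' : EuclideanSpace ℝ (Fin n)) :
    ⟪fderiv ℝ (gradient f) xstar y, y'⟫_ℝ = ⟪y, fderiv ℝ (gradient f) xstar y'⟫_ℝ := by
  let J : EuclideanSpace ℝ (Fin n) →L[ℝ] EuclideanSpace ℝ (Fin n) →L[ℝ] ℝ := innerSL ℝ
  have h1 : ∀ x, HasFDerivAt f (J (gradient f x)) x := fun x => (hf x).hasGradientAt.hasFDerivAt
  have h2 : HasFDerivAt (fun x => J (gradient f x))
      (J.comp (fderiv ℝ (gradient f) xstar)) xstar :=
    J.hasFDerivAt.comp xstar hd.hasFDerivAt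
  have h3 := second_derivative_symmetric h1 h2 y y'
  rw [real_inner_comm _ y]
  exact h3

lemma hessian_norm_le (hL : 0 < L) (hf : IsLSmooth f L) :
    ‖fderiv ℝ (gradient f) xstar‖ ≤ L := by
  simpa [hL.le] using norm_fderiv_le_of_lipschitz ℝ (hf.lipschitzWith hL) (x₀ := xstar)

lemma hessian_inner_le (hL : 0 < L) (hf : IsLSmooth f L) (y : EuclideanSpace ℝ (Fin n)) :
    ⟪y, fderiv ℝ (gradient f) xstar y⟫_ℝ ≤ L * ‖y‖ ^ 2 := by
  have h1 := real_inner_le_norm y (fderiv ℝ (gradient f) xstar y)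
  have h2 := (fderiv ℝ (gradient f) xstar).le_of_opNorm_le (hessian_norm_le hL hf) y
  nlinarith [mul_le_mul_of_nonneg_left h2 (norm_nonneg y)]

lemma le_hessian_inner (hf : Differentiable ℝ f) (hr : 0 < r)
    (hd : DifferentiableAt ℝ (gradient f) xstar)
    (hsc : StrongConvexOn (Metric.ball xstar r) μ f) (y : EuclideanSpace ℝ (Fin n)) :
    μ * ‖y‖ ^ 2 ≤ ⟪y, fderiv ℝ (gradient f) xstar y⟫_ℝ := by
  have hline : HasDerivAt (fun s : ℝ => xstar + s • y) y 0 := by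
    simpa using ((hasDerivAt_id (0 : ℝ)).smul_const y).const_add xstar
  have hd1 : HasFDerivAt (gradient f) (fderiv ℝ (gradient f) xstar) (xstar + (0 : ℝ) • y) := by
    simpa using hd.hasFDerivAt
  have hd2 := hd1.comp_hasDerivAt (0 : ℝ) hline
  rw [hasDerivAt_iff_tendsto_slope_zero] at hd2
  have hd' := hd2.mono_left (nhdsWithin_mono (0 : ℝ) (fun a (ha : a ∈ Set.Ioi 0) => ne_of_gt ha))
  have hlim := (tendsto_const_nhds (x := y)).inner (𝕜 := ℝ) hd'
  refine ge_of_tendsto hlim ?_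
  have hball : ∀ᶠ a in 𝓝[>] (0 : ℝ), xstar + a • y ∈ Metric.ball xstar r := by
    refine Filter.Eventually.filter_mono nhdsWithin_le_nhds ?_
    refine hline.continuousAt.eventually (Metric.isOpen_ball.mem_nhds ?_)
    simpa using hr
  filter_upwards [hball, self_mem_nhdsWithin] with a ha ha0
  have ha0 : 0 < a := ha0
  have h := strongConvex_gradient_monotone hf hsc (Metric.mem_ball_self hr) ha
  simp only [add_sub_cancel_left, norm_smul, inner_smul_right, mul_pow, Real.norm_eq_abs,
    sq_abs] at h
  simp only [Function.comp, zero_add, zero_smul, add_zero, inner_smul_right]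
  rw [real_inner_comm, ← div_eq_inv_mul, le_div_iff₀ ha0]
  have : a * (μ * ‖y‖ ^ 2 * a) ≤ a * ⟪gradient f (xstar + a • y) - gradient f xstar, y⟫_ℝ := by
    linarith
  exact le_of_mul_le_mul_left this ha0

/-- Nonnegativity of the form at `L • y - A y`, combined with the upper bound at `A y`. -/
lemma norm_sq_map_le_of_symm {E : Type*} [NormedAddCommGroup E] [InnerProductSpace ℝ E]
    {A : E →L[ℝ] E} (hL : 0 < L) (hsymm : ∀ y y', ⟪A y, y'⟫_ℝ = ⟪y, A y'⟫_ℝ)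
    (hnonneg : ∀ y, 0 ≤ ⟪y, A y⟫_ℝ) (hub : ∀ y, ⟪y, A y⟫_ℝ ≤ L * ‖y‖ ^ 2) (y : E) :
    ‖A y‖ ^ 2 ≤ L * ⟪y, A y⟫_ℝ := by
  have h1 := hnonneg (L • y - A y)
  have h2 := hub (A y)
  have h3 := hsymm y (A y)
  simp only [map_sub, map_smul, inner_sub_left, inner_sub_right, inner_smul_left, inner_smul_right,
    RCLike.conj_to_real] at h1
  rw [← h3, real_inner_self_eq_norm_sq] at h1
  have : L * ‖A y‖ ^ 2 ≤ L * (L * ⟪y, A y⟫_ℝ) := by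
    linarith
  exact le_of_mul_le_mul_left this hL

/-- Mean value inequality on the ball of radius `δ`, where the Hessian differs from its value at the
centre by at most `|LH| * δ`. -/
lemma norm_gradient_sub_sub_le {δ : ℝ} (hδ : δ ≤ r) (hr : 0 < r)
    (hH : HessianLipschitzOn f LH (Metric.ball xstar r)) {x y : EuclideanSpace ℝ (Fin n)}
    (hx : ‖x - xstar‖ < δ) (hy : ‖y - xstar‖ < δ) :
    ‖gradient f y - gradient f x - fderiv ℝ (gradient f) xstar (y - x)‖ ≤
      |LH| * δ * ‖y - x‖ := by
  have hsub : Metric.ball xstar δ ⊆ Metric.ball xstar r := Metric.ball_subset_ball hδ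
  refine (convex_ball xstar δ).norm_image_sub_le_of_norm_hasFDerivWithin_le'
    (f' := fun w => fderiv ℝ (gradient f) w)
    (fun w hw => ((hH.1 w (hsub hw)).hasFDerivAt).hasFDerivWithinAt) (fun w hw => ?_)
    (mem_ball_iff_norm.2 hx) (mem_ball_iff_norm.2 hy)
  refine (hH.2 w (hsub hw) xstar (Metric.mem_ball_self hr)).trans ?_
  have := mem_ball_iff_norm.1 hw
  calc LH * ‖w - xstar‖ ≤ |LH| * ‖w - xstar‖ := by gcongr; exact le_abs_self _
    _ ≤ _ := by gcongr

end Hessian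

/-! ### From the condition number to quantitative independence of columns. -/

section Conditioning

lemma sum_sq_singularValues {E F : Type*} [NormedAddCommGroup E] [InnerProductSpace ℝ E]
    [FiniteDimensional ℝ E] [NormedAddCommGroup F] [InnerProductSpace ℝ F] [FiniteDimensional ℝ F]
    (T : E →ₗ[ℝ] F) {p : ℕ} (hp : Module.finrank ℝ E = p) (v : E) :
    ‖T v‖ ^ 2 = ∑ i : Fin p, T.singularValues i ^ 2 *
      ⟪T.isSymmetric_adjoint_comp_self.eigenvectorBasis hp i, v⟫_ℝ ^ 2 := by
  set b := T.isSymmetric_adjoint_comp_self.eigenvectorBasis hp with hb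
  have h1 : ‖T v‖ ^ 2 = ⟪v, (LinearMap.adjoint T ∘ₗ T) v⟫_ℝ := by
    rw [LinearMap.comp_apply, LinearMap.adjoint_inner_right, real_inner_self_eq_norm_sq]
  rw [h1, ← b.sum_inner_mul_inner]
  refine Finset.sum_congr rfl fun i _ => ?_
  have h2 := T.isSymmetric_adjoint_comp_self (b i) v
  rw [← h2, hb, LinearMap.IsSymmetric.apply_eigenvectorBasis, ← hb, T.sq_singularValues_fin hp,
    real_inner_comm]
  simp only [RCLike.ofReal_real_eq_id, id_eq, real_inner_smul_left]
  ring

lemma norm_le_singularValue_zero_mul {E F : Type*} [NormedAddCommGroup E] [InnerProductSpace ℝ E]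
    [FiniteDimensional ℝ E] [NormedAddCommGroup F] [InnerProductSpace ℝ F] [FiniteDimensional ℝ F]
    (T : E →ₗ[ℝ] F) (v : E) : ‖T v‖ ≤ T.singularValues 0 * ‖v‖ := by
  refine le_of_sq_le_sq ?_ (mul_nonneg (T.singularValues_nonneg 0) (norm_nonneg v))
  rw [sum_sq_singularValues T rfl, mul_pow,
    ← (T.isSymmetric_adjoint_comp_self.eigenvectorBasis rfl).sum_sq_inner_right v, Finset.mul_sum]
  gcongr with i
  · exact T.singularValues_nonneg _
  · exact T.singularValues_antitone (Nat.zero_le _)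

lemma singularValue_last_mul_le {E F : Type*} [NormedAddCommGroup E] [InnerProductSpace ℝ E]
    [FiniteDimensional ℝ E] [NormedAddCommGroup F] [InnerProductSpace ℝ F] [FiniteDimensional ℝ F]
    (T : E →ₗ[ℝ] F) (v : E) :
    T.singularValues (Module.finrank ℝ E - 1) * ‖v‖ ≤ ‖T v‖ := by
  refine le_of_sq_le_sq ?_ (norm_nonneg _)
  rw [sum_sq_singularValues T rfl, mul_pow,
    ← (T.isSymmetric_adjoint_comp_self.eigenvectorBasis rfl).sum_sq_inner_right v, Finset.mul_sum]
  gcongr with i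
  · exact T.singularValues_nonneg _
  · exact T.singularValues_antitone (by omega)

/-- If the Gram matrix of the columns of `X` has condition number at most `M²`, the columns are
linearly independent, in a way quantified by their norms. -/
lemma norm_col_mul_le_of_condNumber {n p : ℕ}
    (v : Fin p → EuclideanSpace ℝ (Fin n)) {M : ℝ}
    (h : condNumber ((Matrix.of fun i j => v j i)ᵀ * Matrix.of fun i j => v j i) ≤
      ENNReal.ofReal (M ^ 2)) :
    (∀ i, v i ≠ 0) ∧ ∀ (b : Fin p → ℝ) (i j : Fin p),
      ‖v i‖ * |b j| ≤ M ^ 2 * ‖∑ j, b j • v j‖ := by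
  set S := (Matrix.of fun i j => v j i)ᵀ * Matrix.of fun i j => v j i with hS
  set T := Matrix.toEuclideanLin S with hT
  let W : EuclideanSpace ℝ (Fin p) → EuclideanSpace ℝ (Fin n) := fun b => ∑ j, b j • v j
  have hW : ∀ a b, ⟪a, T b⟫_ℝ = ⟪W a, W b⟫_ℝ := by
    intro a b
    have e : ∀ a : EuclideanSpace ℝ (Fin p),
        (W a).ofLp = (Matrix.of fun i j => v j i) *ᵥ a.ofLp := by
      intro a
      ext i
      simp [W, Matrix.mulVec, dotProduct, mul_comm]
    rw [EuclideanSpace.inner_eq_star_dotProduct, EuclideanSpace.inner_eq_star_dotProduct, e, e, hT,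
      hS, Matrix.toEuclideanLin, Matrix.ofLp_toLpLin, Matrix.toLin'_apply, ← Matrix.mulVec_mulVec, star_trivial, star_trivial,
      dotProduct_comm, dotProduct_comm _ (_ *ᵥ a.ofLp), Matrix.dotProduct_mulVec,
      Matrix.vecMul_transpose]
  unfold condNumber at h
  split_ifs at h with h0
  · exact absurd h (by simp)
  rw [ENNReal.ofReal_le_ofReal_iff (sq_nonneg M)] at h
  set σ₀ := T.singularValues 0
  set σ₁ := T.singularValues (p - 1)
  have hσ₁ : 0 < σ₁ := (T.singularValues_pos_iff_ne_zero _).2 h0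
  have hσ₀ : 0 < σ₀ := hσ₁.trans_le (T.singularValues_antitone (Nat.zero_le _))
  rw [div_le_iff₀ hσ₁] at h
  have hup : ∀ b, ‖W b‖ ^ 2 ≤ σ₀ * ‖b‖ ^ 2 := by
    intro b
    rw [← real_inner_self_eq_norm_sq, ← hW]
    have h1 := real_inner_le_norm b (T b)
    have h2 := norm_le_singularValue_zero_mul T b
    nlinarith [mul_le_mul_of_nonneg_left h2 (norm_nonneg b)]
  -- This follows from `‖T b‖ ^ 2 = ⟪W (T b), W b⟫` and `hup`, with no square root of the Gram
  -- operator; the price is the factor `M ^ 2` in place of `|M|`.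
  have hlow : ∀ b, σ₁ ^ 2 * ‖b‖ ^ 2 ≤ σ₀ * ‖W b‖ ^ 2 := by
    intro b
    have h1 : σ₁ * ‖b‖ ≤ ‖T b‖ := by
      simpa [σ₁] using singularValue_last_mul_le T b
    have h2 : σ₁ ^ 2 * ‖b‖ ^ 2 ≤ ‖T b‖ ^ 2 := by
      rw [← mul_pow]; exact pow_le_pow_left₀ (by positivity) h1 2
    refine h2.trans ?_
    have h3 : ‖T b‖ ^ 2 ≤ ‖W (T b)‖ * ‖W b‖ := by
      rw [← real_inner_self_eq_norm_sq, hW]; exact real_inner_le_norm _ _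
    have h4 := hup (T b)
    rcases (sq_nonneg ‖T b‖).eq_or_lt with hz | hz
    · rw [← hz]; positivity
    · refine le_of_mul_le_mul_left ?_ hz
      calc ‖T b‖ ^ 2 * ‖T b‖ ^ 2 ≤ (‖W (T b)‖ * ‖W b‖) * (‖W (T b)‖ * ‖W b‖) := by gcongr
        _ = ‖W (T b)‖ ^ 2 * ‖W b‖ ^ 2 := by ring
        _ ≤ (σ₀ * ‖T b‖ ^ 2) * ‖W b‖ ^ 2 := by gcongr
        _ = _ := by ring
  have hsingle : ∀ i, W (EuclideanSpace.single i 1) = v i := by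
    intro i
    simp [W, ite_smul]
  refine ⟨fun i hi => ?_, fun b i j => ?_⟩
  · have h1 := hlow (EuclideanSpace.single i 1)
    rw [hsingle, hi] at h1
    simp only [PiLp.norm_single, norm_one, one_pow, mul_one, norm_zero] at h1
    nlinarith [pow_pos hσ₁ 2]
  · have h1 := hup (EuclideanSpace.single i 1)
    rw [hsingle] at h1
    simp only [PiLp.norm_single, norm_one, one_pow, mul_one] at h1
    set b' : EuclideanSpace ℝ (Fin p) := WithLp.toLp 2 b
    have h2 : |b j| ≤ ‖b'‖ := PiLp.norm_apply_le b' j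
    have h3 := hlow b'
    have h4 : σ₀ * ‖b'‖ ^ 2 ≤ (M ^ 2) ^ 2 * ‖W b'‖ ^ 2 := by
      refine le_of_mul_le_mul_left ?_ hσ₀
      calc σ₀ * (σ₀ * ‖b'‖ ^ 2) = σ₀ ^ 2 * ‖b'‖ ^ 2 := by ring
        _ ≤ (M ^ 2 * σ₁) ^ 2 * ‖b'‖ ^ 2 := by gcongr
        _ = (M ^ 2) ^ 2 * (σ₁ ^ 2 * ‖b'‖ ^ 2) := by ring
        _ ≤ (M ^ 2) ^ 2 * (σ₀ * ‖W b'‖ ^ 2) := by gcongr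
        _ = _ := by ring
    have h5 : ‖v i‖ * |b j| ≤ M ^ 2 * ‖W b'‖ := by
      refine le_of_sq_le_sq ?_ (by positivity)
      rw [mul_pow, mul_pow]
      refine le_trans ?_ h4
      gcongr
    exact h5

end Conditioning

/-! ### From the quadratic form to the true gradient at the accelerated step. -/

section Gain

open Asymptotics

variable {E : Type*} [NormedAddCommGroup E] [InnerProductSpace ℝ E]
  {ι : Type*} {F : Filter ι} {A : E →L[ℝ] E} {L : ℝ} {k : ℕ} {t : ι → ℝ}
  {X Y R D : ι → ℕ → E} {α : ι → ℕ → ℕ → ℝ} {μ : ℝ}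

/-- First order gain of the accelerated step over the gradient step, `G` being the gradient at the
accelerated step. -/
lemma IsNearlyLinearAA.gradient_gain_lower_bound [ProperSpace E]
    (h : IsNearlyLinearAA F A L k t X Y R D α) {p : ℕ} (hk : k = p + 1) (hL : 0 < L)
    (hsymm : ∀ y y', ⟪A y, y'⟫_ℝ = ⟪y, A y'⟫_ℝ)
    (hpos : ∀ y, y ≠ 0 → 0 < ⟪y, A y⟫_ℝ) (hcoc : ∀ y, ‖A y‖ ^ 2 ≤ L * ⟪y, A y⟫_ℝ)
    (hub : ∀ y, ⟪y, A y⟫_ℝ ≤ L * ‖y‖ ^ 2)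
    (hμ : 0 < μ) (hA : ∀ y, μ * ‖y‖ ≤ ‖A y‖) {G : ι → E}
    (hG : (fun l => G l - R l 0 - A (D l k - (1 / L) • R l k)) =O[F] fun l => t l ^ 2) :
    ∃ C, ∀ ε > 0, ∀ᶠ l in F, -(ε * ‖R l k‖ ^ 2) - C * t l ^ 3 ≤
      ⟪G l, X l p - D l k - (1 / L) • (R l 0 + Y l p - R l k)⟫_ℝ := by
  obtain ⟨C, hC⟩ := h.gain_lower_bound hk hL hsymm hpos hcoc hub hμ hA
  have hE : (fun l => ∑ i ∈ Finset.range k, α l k i • (Y l i - A (X l i)))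
      =O[F] fun l => t l ^ 2 := by
    refine IsBigO.fun_sum fun i hi => ?_
    have hi := Finset.mem_range.1 hi
    simpa using (h.coeff_isBigO hμ hA le_rfl hi).smul (h.Y_approx i hi)
  have hp : p < k := by omega
  have he2 := (h.Y_approx p hp).sub hE
  have hq : ∀ l, R l 0 + Y l p - R l k = A (X l p - D l k) + (Y l p - A (X l p) -
      ∑ i ∈ Finset.range k, α l k i • (Y l i - A (X l i))) := by
    intro l
    rw [h.R_eq l k le_rfl, h.D_eq l k le_rfl, map_sub, map_sum]
    simp only [map_smul, smul_sub, Finset.sum_sub_distrib]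
    abel
  have hv : (fun l => X l p - D l k) =O[F] t := (h.X_isBigO p hp).sub (h.D_isBigO hμ hA le_rfl)
  have hqO : (fun l => R l 0 + Y l p - R l k) =O[F] t := by
    have h1 : (fun l => t l ^ 2) =O[F] t := by
      have : (fun l => t l * t l) =O[F] fun l => 1 * t l :=
        (h.t_zero.isBigO_one ℝ).mul (isBigO_refl t F)
      simpa [sq] using this
    exact (((A.isBigO_comp _ F).trans hv).add (he2.trans h1)).congr_left fun l => (hq l).symm
  have hG' : (fun l => G l - R l k + (1 / L) • A (R l k)) =O[F] fun l => t l ^ 2 := by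
    refine (hG.sub hE).congr_left fun l => ?_
    rw [map_sub, map_smul, h.D_eq l k le_rfl, map_sum]
    simp only [map_smul, smul_sub, Finset.sum_sub_distrib]
    rw [eq_sub_of_add_eq' (h.R_eq l k le_rfl).symm]
    abel
  have herr := ((isBigO_inner (h.R_isBigO le_rfl) he2).const_mul_left (1 / L)).add
    ((isBigO_inner hG' (hv.sub (hqO.const_smul_left (1 / L)))).congr_right fun l => by ring)
  have herr3 := herr.trans (isBigO_of_le F (g := fun l => t l ^ 3) fun l => by
    rw [show t l * t l ^ 2 = t l ^ 3 by ring])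
  obtain ⟨C', hC'⟩ := herr3.bound
  refine ⟨C + |C'|, fun ε hε => ?_⟩
  filter_upwards [hC ε hε, hC', h.t_pos] with l hl hl' htl
  set e2 := Y l p - A (X l p) - ∑ i ∈ Finset.range k, α l k i • (Y l i - A (X l i)) with he2def
  set q := R l 0 + Y l p - R l k with hqdef
  set v := X l p - D l k with hvdef
  set G' := G l - R l k + (1 / L) • A (R l k) with hG'def
  -- Here `q` is the current gradient minus the mixed one. This pairing vanishes exactly, and since
  -- `q = A v + e2`, the other cross term `⟪A (R l k), v⟫` is only of order `t ^ 3`.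
  have hRq : ⟪R l k, q⟫_ℝ = 0 := by
    rw [hqdef, inner_sub_right, inner_add_right, h.inner_R_sub l le_rfl (Nat.zero_le k),
      h.orth l k le_rfl p hp, real_inner_self_eq_norm_sq]
    ring
  have hARv : ⟪A (R l k), v⟫_ℝ = -⟪R l k, e2⟫_ℝ := by
    have e := hq l
    rw [← hqdef, ← hvdef, ← he2def] at e
    rw [e, inner_add_right] at hRq
    rw [hsymm]
    linarith
  have hGe : G l = R l k - (1 / L) • A (R l k) + G' := by rw [hG'def]; abel
  have key : ⟪G l, v - (1 / L) • q⟫_ℝ = ⟪R l k, v⟫_ℝ + 1 / L ^ 2 * ⟪A (R l k), q⟫_ℝ +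
      (1 / L * ⟪R l k, e2⟫_ℝ + ⟪G', v - (1 / L) • q⟫_ℝ) := by
    rw [hGe, inner_add_left]
    have : ⟪R l k - (1 / L) • A (R l k), v - (1 / L) • q⟫_ℝ = ⟪R l k, v⟫_ℝ +
        1 / L ^ 2 * ⟪A (R l k), q⟫_ℝ + 1 / L * ⟪R l k, e2⟫_ℝ := by
      simp only [inner_sub_left, inner_sub_right, inner_smul_right, real_inner_smul_left, hRq, hARv]
      ring
    rw [this]
    ring
  rw [key]
  have hb : -(|C'| * t l ^ 3) ≤ 1 / L * ⟪R l k, e2⟫_ℝ + ⟪G', v - (1 / L) • q⟫_ℝ := by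
    have h1 : |1 / L * ⟪R l k, e2⟫_ℝ + ⟪G', v - (1 / L) • q⟫_ℝ| ≤ |C'| * t l ^ 3 := by
      refine hl'.trans ?_
      rw [Real.norm_of_nonneg (by positivity)]
      gcongr
      exact le_abs_self C'
    linarith [neg_abs_le (1 / L * ⟪R l k, e2⟫_ℝ + ⟪G', v - (1 / L) • q⟫_ℝ)]
  linarith

end Gain

/-! ### The mixing problem as orthogonality of gradients within one cycle. -/

section Cycle

variable {n : ℕ} {f : EuclideanSpace ℝ (Fin n) → ℝ} {L : ℝ} {m : ℕ}

/-- `w` is an Anderson accelerated step computed from the `d + 1` points `u 0, …, u d`. -/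
def IsAAStepFrom (f : EuclideanSpace ℝ (Fin n) → ℝ) (L : ℝ)
    (u : ℕ → EuclideanSpace ℝ (Fin n)) (d : ℕ) (w : EuclideanSpace ℝ (Fin n)) : Prop :=
  ∃ α : Fin d → ℝ,
    (∀ β : Fin d → ℝ,
      ‖residual f L (u 0) + ∑ j, α j • (residual f L (u (j + 1)) - residual f L (u 0))‖ ^ 2 ≤
      ‖residual f L (u 0) + ∑ j, β j • (residual f L (u (j + 1)) - residual f L (u 0))‖ ^ 2) ∧
    w = gradStep f L (u 0) + ∑ j, α j • (gradStep f L (u (j + 1)) - gradStep f L (u 0))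

lemma isAAStep_iff (x : ℕ → EuclideanSpace ℝ (Fin n)) (k : ℕ) (w : EuclideanSpace ℝ (Fin n)) :
    IsAAStep f L m x k w ↔
      IsAAStepFrom f L (fun i => x (k - depth m k + i)) (depth m k) w := Iff.rfl

lemma isAAStep_shift_iff (x : ℕ → EuclideanSpace ℝ (Fin n)) (s k : ℕ)
    (w : EuclideanSpace ℝ (Fin n)) :
    IsAAStep f L m (fun i => x (s * (m + 1) + i)) k w ↔ IsAAStep f L m x (s * (m + 1) + k) w := by
  have hd : depth m (s * (m + 1) + k) = depth m k := by
    rw [depth, depth, add_comm, Nat.add_mul_mod_self_right]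
  have hle : depth m k ≤ k := Nat.mod_le _ _
  rw [isAAStep_iff, isAAStep_iff, hd, Nat.add_sub_assoc hle]
  simp only [add_assoc]

lemma isAAStep_cycle_iff (x : ℕ → EuclideanSpace ℝ (Fin n)) (l : ℕ) {j : ℕ} (hj : j ≤ m)
    (w : EuclideanSpace ℝ (Fin n)) :
    IsAAStep f L m x (l * (m + 1) + j) w ↔
      IsAAStepFrom f L (fun i => x (l * (m + 1) + i)) j w := by
  rw [isAAStep_iff, depth_cycle l hj, Nat.add_sub_cancel]

lemma inner_eq_zero_of_norm_sq_le {E : Type*} [NormedAddCommGroup E] [InnerProductSpace ℝ E]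
    {y y' : E} (h : ∀ s : ℝ, ‖y‖ ^ 2 ≤ ‖y + s • y'‖ ^ 2) : ⟪y, y'⟫_ℝ = 0 := by
  -- Almost the minimizing `s`; the `+ 1` keeps the denominator positive when `y' = 0`.
  have h1 := h (-⟪y, y'⟫_ℝ / (‖y'‖ ^ 2 + 1))
  rw [norm_add_sq_real, inner_smul_right, norm_smul, mul_pow, Real.norm_eq_abs, sq_abs] at h1
  set c := ⟪y, y'⟫_ℝ
  set N := ‖y'‖ ^ 2
  have hN : 0 ≤ N := sq_nonneg _
  have h2 : 2 * (-c / (N + 1) * c) + (-c / (N + 1)) ^ 2 * N = -(c ^ 2 * (N + 2)) / (N + 1) ^ 2 := by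
    field_simp
    ring
  have h3 : 0 ≤ -(c ^ 2 * (N + 2)) / (N + 1) ^ 2 := by linarith
  rw [le_div_iff₀ (by positivity)] at h3
  have h4 : c ^ 2 ≤ 0 := by nlinarith [sq_nonneg c]
  exact pow_eq_zero_iff two_ne_zero |>.1 (le_antisymm h4 (sq_nonneg c))

/-- The mixing problem in terms of gradients: the mixed gradient is orthogonal to the gradient
increments, and the accelerated step is a gradient step from the mixed point. -/
lemma IsAAStepFrom.exists_coeff (hL : 0 < L) {u : ℕ → EuclideanSpace ℝ (Fin n)} {d : ℕ}
    {w : EuclideanSpace ℝ (Fin n)} (h : IsAAStepFrom f L u d w) :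
    ∃ a : ℕ → ℝ,
      (∀ i < d, ⟪gradient f (u 0) +
        ∑ i ∈ Finset.range d, a i • (gradient f (u (i + 1)) - gradient f (u 0)),
        gradient f (u (i + 1)) - gradient f (u 0)⟫_ℝ = 0) ∧
      w = u 0 + ∑ i ∈ Finset.range d, a i • (u (i + 1) - u 0) - (1 / L) • (gradient f (u 0) +
        ∑ i ∈ Finset.range d, a i • (gradient f (u (i + 1)) - gradient f (u 0))) := by
  obtain ⟨α, hα, hw⟩ := h
  have hres : ∀ β : Fin d → ℝ,
      residual f L (u 0) + ∑ j, β j • (residual f L (u (j + 1)) - residual f L (u 0)) =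
      -((1 / L) • (gradient f (u 0) +
        ∑ j : Fin d, β j • (gradient f (u (j + 1)) - gradient f (u 0)))) := by
    intro β
    simp only [residual_eq, smul_add, Finset.smul_sum, neg_add, ← Finset.sum_neg_distrib]
    congr 1
    refine Finset.sum_congr rfl fun j _ => ?_
    module
  have hmin : ∀ β : Fin d → ℝ,
      ‖gradient f (u 0) + ∑ j : Fin d, α j • (gradient f (u (j + 1)) - gradient f (u 0))‖ ^ 2 ≤
      ‖gradient f (u 0) + ∑ j : Fin d, β j • (gradient f (u (j + 1)) - gradient f (u 0))‖ ^ 2 := by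
    intro β
    have h1 := hα β
    rw [hres, hres, norm_neg, norm_neg, norm_smul, norm_smul, mul_pow, mul_pow] at h1
    exact le_of_mul_le_mul_left h1 (pow_pos (norm_pos_iff.2 (by positivity)) 2)
  let a : ℕ → ℝ := fun i => if hi : i < d then α ⟨i, hi⟩ else 0
  have ha : ∀ j : Fin d, a j = α j := fun j => by simp [a]
  refine ⟨a, fun i hi => ?_, ?_⟩
  · rw [Finset.sum_range]
    simp only [ha]
    refine inner_eq_zero_of_norm_sq_le fun s => ?_
    refine (hmin (α + Pi.single ⟨i, hi⟩ s)).trans (le_of_eq ?_)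
    congr 2
    simp [add_smul, Finset.sum_add_distrib, Pi.single_apply, ite_smul, add_assoc]
  · rw [hw, Finset.sum_range, Finset.sum_range]
    simp only [ha, gradStep, smul_add, Finset.smul_sum]
    have : ∀ j : Fin d, α j • (u (↑j + 1) - (1 / L) • gradient f (u (↑j + 1)) -
        (u 0 - (1 / L) • gradient f (u 0))) = α j • (u (↑j + 1) - u 0) -
        (1 / L) • α j • (gradient f (u (↑j + 1)) - gradient f (u 0)) := fun j => by module
    simp only [this, Finset.sum_sub_distrib]
    abel

end Cycle

/-! ### Cycles near the minimizer are nearly linear runs. -/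

section Local

open Asymptotics

variable {n : ℕ}

/-- Increments of `u` within the `l`-th cycle, relative to the start of the cycle. -/
def cycleDiff {E : Type*} [AddGroup E] (m : ℕ) (u : ℕ → E) (l i : ℕ) : E :=
  u (l * (m + 1) + (i + 1)) - u (l * (m + 1))

/-- Mixed increments of the `l`-th cycle. -/
def mixedDiff {E : Type*} [AddCommGroup E] [Module ℝ E] (m : ℕ) (u : ℕ → E)
    (α : ℕ → ℕ → ℕ → ℝ) (l j : ℕ) : E :=
  ∑ i ∈ Finset.range j, α l j i • cycleDiff m u l i

/-- Mixed values of the `l`-th cycle. -/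
def mixedValue {E : Type*} [AddCommGroup E] [Module ℝ E] (m : ℕ) (u : ℕ → E)
    (α : ℕ → ℕ → ℕ → ℝ) (l j : ℕ) : E :=
  u (l * (m + 1)) + mixedDiff m u α l j

/-- A run of the globalized scheme together with a strict local minimizer `xstar` that satisfies the
second order assumptions, and with mixing coefficients `α` of the accelerated steps. -/
structure IsLocalRun (f : EuclideanSpace ℝ (Fin n) → ℝ) (L : ℝ) (m : ℕ) (γ ν c₁ c₂ c₃ : ℝ)
    (x z : ℕ → EuclideanSpace ℝ (Fin n)) (xstar : EuclideanSpace ℝ (Fin n)) (r μ LH M : ℝ)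
    (α : ℕ → ℕ → ℕ → ℝ) : Prop where
  L_pos : 0 < L
  smooth : IsLSmooth f L
  run : IsGlobalizedAAR f L m γ ν c₁ c₂ c₃ x z
  m_pos : 1 ≤ m
  r_pos : 0 < r
  μ_pos : 0 < μ
  gradient_eq_zero : gradient f xstar = 0
  strongConvex : StrongConvexOn (Metric.ball xstar r) μ f
  hessian : HessianLipschitzOn f LH (Metric.ball xstar r)
  condBound : CondBound m x M
  orth : ∀ l, ∀ j ≤ m, ∀ i < j,
    ⟪mixedValue m (fun k => gradient f (x k)) α l j,
      cycleDiff m (fun k => gradient f (x k)) l i⟫_ℝ = 0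
  candidate_eq : ∀ l, ∀ j ≤ m, j ≠ 0 → z (l * (m + 1) + j) = x (l * (m + 1)) +
    mixedDiff m x α l j - (1 / L) • mixedValue m (fun k => gradient f (x k)) α l j

variable {f : EuclideanSpace ℝ (Fin n) → ℝ} {L : ℝ} {m : ℕ} {γ ν c₁ c₂ c₃ : ℝ}
  {x z : ℕ → EuclideanSpace ℝ (Fin n)} {xstar : EuclideanSpace ℝ (Fin n)} {r μ LH M : ℝ}
  {α : ℕ → ℕ → ℕ → ℝ}

lemma exists_mixing (hL : 0 < L) (hx : IsGlobalizedAAR f L m γ ν c₁ c₂ c₃ x z) :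
    ∃ α : ℕ → ℕ → ℕ → ℝ, (∀ l, ∀ j ≤ m, ∀ i < j,
      ⟪mixedValue m (fun k => gradient f (x k)) α l j,
        cycleDiff m (fun k => gradient f (x k)) l i⟫_ℝ = 0) ∧
      ∀ l, ∀ j ≤ m, j ≠ 0 → z (l * (m + 1) + j) = x (l * (m + 1)) +
        mixedDiff m x α l j - (1 / L) • mixedValue m (fun k => gradient f (x k)) α l j := by
  have key : ∀ l j, ∃ a : ℕ → ℝ, j ≤ m → j ≠ 0 → _ := fun l j => by
    by_cases hj : j ≤ m ∧ j ≠ 0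
    · obtain ⟨a, ha⟩ := ((isAAStep_cycle_iff x l hj.1 _).1
        (hx.candidate (l * (m + 1) + j) (by rw [depth_cycle l hj.1]; exact hj.2))).exists_coeff hL
      exact ⟨a, fun _ _ => ha⟩
    · exact ⟨0, fun h1 h2 => absurd ⟨h1, h2⟩ hj⟩
  choose α hα using key
  exact ⟨α, fun l j hj i hi => (hα l j hj (by omega)).1 i hi,
    fun l j hj hj0 => (hα l j hj hj0).2⟩

namespace IsLocalRun

variable (h : IsLocalRun f L m γ ν c₁ c₂ c₃ x z xstar r μ LH M α)
include h

/-- The last index of a cycle has full depth `m`, so its matrix contains the columns of all smaller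
depths; this single instance of the conditioning bound suffices. -/
lemma norm_cycleDiff_mul_le (l : ℕ) :
    (∀ i < m, cycleDiff m x l i ≠ 0) ∧ ∀ (b : ℕ → ℝ), ∀ i < m, ∀ j < m,
      ‖cycleDiff m x l i‖ * |b j| ≤
        M ^ 2 * ‖∑ i ∈ Finset.range m, b i • cycleDiff m x l i‖ := by
  have hd := depth_cycle (m := m) l le_rfl
  have hm := h.m_pos
  obtain ⟨h1, h2⟩ := norm_col_mul_le_of_condNumber (diffCol m x (l * (m + 1) + m))
    (h.condBound (l * (m + 1) + m) (by omega))
  have e : ∀ j, diffCol m x (l * (m + 1) + m) j = cycleDiff m x l j := by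
    intro j
    simp only [diffCol, cycleDiff, hd, Nat.add_sub_cancel]
  refine ⟨fun i hi => ?_, fun b i hi j hj => ?_⟩
  · rw [← e ⟨i, by omega⟩]
    exact h1 _
  · have h3 := h2 (fun i => b i) ⟨i, by omega⟩ ⟨j, by omega⟩
    simp only [e] at h3
    rwa [← Finset.sum_range (fun i => b i • cycleDiff m x l i), hd] at h3

lemma cycleDiff_zero (l : ℕ) :
    cycleDiff m x l 0 = -((1 / L) • gradient f (x (l * (m + 1)))) := by
  have := h.run.restart (l * (m + 1)) (depth_cycle (m := m) l (Nat.zero_le m))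
  rw [cycleDiff, zero_add, this, gradStep]
  abel

/-- A stationary cycle start would make the first column zero and the Gram matrix singular. -/
lemma norm_gradient_pos (l : ℕ) : 0 < ‖gradient f (x (l * (m + 1)))‖ := by
  refine norm_pos_iff.2 fun h0 => (h.norm_cycleDiff_mul_le l).1 0 h.m_pos ?_
  rw [h.cycleDiff_zero, h0, smul_zero, neg_zero]

lemma norm_cycleDiff_zero (l : ℕ) :
    ‖cycleDiff m x l 0‖ = ‖gradient f (x (l * (m + 1)))‖ / L := by
  rw [h.cycleDiff_zero, norm_neg, norm_smul, Real.norm_of_nonneg (by have := h.L_pos; positivity)]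
  ring

/-- Conditioning, applied to the first column alone, makes every column at most a multiple of the
first, which is a gradient step. -/
lemma norm_cycleDiff_le (l : ℕ) {i : ℕ} (hi : i < m) :
    ‖cycleDiff m x l i‖ ≤ M ^ 2 / L * ‖gradient f (x (l * (m + 1)))‖ := by
  have h1 := (h.norm_cycleDiff_mul_le l).2 (Pi.single 0 1) i hi 0 h.m_pos
  have h2 : ∑ i ∈ Finset.range m, (Pi.single 0 1 : ℕ → ℝ) i • cycleDiff m x l i =
      cycleDiff m x l 0 := by
    rw [Finset.sum_eq_single_of_mem 0 (Finset.mem_range.2 h.m_pos)]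
    · simp
    · intro i _ hi
      simp [Pi.single_eq_of_ne hi]
  rw [h2, h.norm_cycleDiff_zero, Pi.single_eq_same, abs_one, mul_one] at h1
  exact h1.trans (le_of_eq (by ring))

lemma coeff_le (l : ℕ) {k : ℕ} (hk : k ≤ m) (b : ℕ → ℝ) {i : ℕ} (hi : i < k) :
    1 / (L * (M ^ 2 + 1)) * ‖gradient f (x (l * (m + 1)))‖ * |b i| ≤
      ‖∑ i ∈ Finset.range k, b i • cycleDiff m x l i‖ := by
  have hL := h.L_pos
  have h1 := (h.norm_cycleDiff_mul_le l).2 (fun i => if i < k then b i else 0) 0 h.m_pos i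
    (by omega)
  have h2 : ∑ i ∈ Finset.range m, (if i < k then b i else 0) • cycleDiff m x l i =
      ∑ i ∈ Finset.range k, b i • cycleDiff m x l i := by
    refine (Finset.sum_subset_zero_on_sdiff (Finset.range_mono hk) ?_ ?_).symm
    · intro i hi
      rw [Finset.mem_sdiff, Finset.mem_range, Finset.mem_range] at hi
      rw [if_neg hi.2, zero_smul]
    · intro i hi
      rw [if_pos (Finset.mem_range.1 hi)]
  rw [h2, if_pos hi, h.norm_cycleDiff_zero] at h1
  have h3 : 1 / (L * (M ^ 2 + 1)) * ‖gradient f (x (l * (m + 1)))‖ * |b i| =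
      (‖gradient f (x (l * (m + 1)))‖ / L * |b i|) / (M ^ 2 + 1) := by
    field_simp
  rw [h3, div_le_iff₀ (by positivity)]
  nlinarith [norm_nonneg (∑ i ∈ Finset.range k, b i • cycleDiff m x l i)]

lemma continuous_gradient : Continuous (gradient f) :=
  (h.smooth.lipschitzWith h.L_pos).continuous

lemma norm_sub_le_gradient {y : EuclideanSpace ℝ (Fin n)} (hy : y ∈ Metric.ball xstar r) :
    μ * ‖y - xstar‖ ≤ ‖gradient f y‖ := by
  have h1 := strongConvex_gradient_monotone h.smooth.1 h.strongConvex
    (Metric.mem_ball_self h.r_pos) hy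
  rw [h.gradient_eq_zero, sub_zero] at h1
  have h2 := real_inner_le_norm (gradient f y) (y - xstar)
  rcases (norm_nonneg (y - xstar)).eq_or_lt with h0 | h0
  · rw [← h0, mul_zero]; exact norm_nonneg _
  · refine le_of_mul_le_mul_right ?_ h0
    linarith

/-- The `comap` filter expresses "as the cycle start approaches `xstar`", which permits local
asymptotics before the starts are known to converge. -/
lemma tendsto_norm_gradient_start :
    Tendsto (fun l => ‖gradient f (x (l * (m + 1)))‖)
      (comap (fun l => x (l * (m + 1))) (𝓝 xstar)) (𝓝 0) := by
  have h1 := (h.continuous_gradient.tendsto xstar).norm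
  rw [h.gradient_eq_zero, norm_zero] at h1
  exact h1.comp tendsto_comap

lemma start_isBigO :
    (fun l => x (l * (m + 1)) - xstar) =O[comap (fun l => x (l * (m + 1))) (𝓝 xstar)]
      fun l => ‖gradient f (x (l * (m + 1)))‖ := by
  refine IsBigO.of_bound (1 / μ) ?_
  filter_upwards [tendsto_comap.eventually (Metric.ball_mem_nhds xstar h.r_pos)] with l hl
  have := h.norm_sub_le_gradient hl
  rw [norm_norm, one_div, inv_mul_eq_div, le_div_iff₀ h.μ_pos]
  linarith

/-- First order expansion of the gradient between points close to the minimizer. -/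
lemma gradient_expansion {u v : ℕ → EuclideanSpace ℝ (Fin n)}
    (hu : (fun l => u l - xstar) =O[comap (fun l => x (l * (m + 1))) (𝓝 xstar)]
      fun l => ‖gradient f (x (l * (m + 1)))‖)
    (hv : (fun l => v l - xstar) =O[comap (fun l => x (l * (m + 1))) (𝓝 xstar)]
      fun l => ‖gradient f (x (l * (m + 1)))‖) :
    (fun l => gradient f (v l) - gradient f (u l) - fderiv ℝ (gradient f) xstar (v l - u l))
      =O[comap (fun l => x (l * (m + 1))) (𝓝 xstar)]
      fun l => ‖gradient f (x (l * (m + 1)))‖ ^ 2 := by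
  obtain ⟨C, hC0, hC⟩ := hu.exists_pos
  obtain ⟨C', hC0', hC'⟩ := hv.exists_pos
  have ht := h.tendsto_norm_gradient_start
  have hsmall : ∀ᶠ l in comap (fun l => x (l * (m + 1))) (𝓝 xstar),
      (C + C') * ‖gradient f (x (l * (m + 1)))‖ < r := by
    have h1 := ht.const_mul (C + C')
    rw [mul_zero] at h1
    exact h1.eventually (gt_mem_nhds h.r_pos)
  refine IsBigO.of_bound (|LH| * (C + C') * (C + C')) ?_
  filter_upwards [hC.bound, hC'.bound, hsmall] with l hl hl' hs
  rw [norm_norm] at hl hl'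
  have htl := h.norm_gradient_pos l
  set t := ‖gradient f (x (l * (m + 1)))‖
  have h1 : ‖v l - u l‖ ≤ (C + C') * t := by
    have e : v l - u l = (v l - xstar) - (u l - xstar) := by abel
    rw [e]
    exact (norm_sub_le _ _).trans (by linarith)
  have h2 := norm_gradient_sub_sub_le (δ := (C + C') * t) hs.le h.r_pos h.hessian (x := u l)
    (y := v l) (by nlinarith) (by nlinarith)
  refine h2.trans ?_
  rw [Real.norm_of_nonneg (by positivity)]
  calc |LH| * ((C + C') * t) * ‖v l - u l‖ ≤ |LH| * ((C + C') * t) * ((C + C') * t) := by gcongr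
    _ = _ := by ring

lemma cycleDiff_isBigO {i : ℕ} (hi : i < m) :
    (fun l => cycleDiff m x l i) =O[comap (fun l => x (l * (m + 1))) (𝓝 xstar)]
      fun l => ‖gradient f (x (l * (m + 1)))‖ :=
  IsBigO.of_bound _ (Eventually.of_forall fun l => by
    simpa using h.norm_cycleDiff_le l hi)

lemma iterate_isBigO {i : ℕ} (hi : i ≤ m) :
    (fun l => x (l * (m + 1) + i) - xstar) =O[comap (fun l => x (l * (m + 1))) (𝓝 xstar)]
      fun l => ‖gradient f (x (l * (m + 1)))‖ := by
  cases i with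
  | zero => exact h.start_isBigO
  | succ i =>
    refine ((h.cycleDiff_isBigO hi).add h.start_isBigO).congr_left fun l => ?_
    rw [cycleDiff]; abel

/-- The relation `X = D - R / L` needs the candidates of smaller depth to have been taken, hence
`hacc`; at depth zero it is the gradient step with an empty mixture. -/
lemma isNearlyLinearAA {k : ℕ} (hk : k ≤ m)
    (hacc : ∀ j < k, j ≠ 0 → ∀ᶠ l in comap (fun l => x (l * (m + 1))) (𝓝 xstar),
      Accepted f m γ ν c₁ c₂ c₃ x (l * (m + 1) + j) (z (l * (m + 1) + j))) :
    IsNearlyLinearAA (comap (fun l => x (l * (m + 1))) (𝓝 xstar)) (fderiv ℝ (gradient f) xstar) L k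
      (fun l => ‖gradient f (x (l * (m + 1)))‖) (cycleDiff m x)
      (cycleDiff m fun k => gradient f (x k)) (mixedValue m (fun k => gradient f (x k)) α)
      (mixedDiff m x α) α where
  t_pos := Eventually.of_forall h.norm_gradient_pos
  t_zero := h.tendsto_norm_gradient_start
  norm_R_zero l := by simp [mixedValue, mixedDiff]
  D_eq _ _ _ := rfl
  R_eq l j _ := by simp [mixedValue, mixedDiff]
  orth l j hj i hi := h.orth l j (hj.trans hk) i hi
  X_eq j hj := by
    rcases eq_or_ne j 0 with rfl | hj0
    · refine Eventually.of_forall fun l => ?_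
      rw [h.cycleDiff_zero]
      simp [mixedValue, mixedDiff]
    · filter_upwards [hacc j hj hj0] with l hl
      have e := h.run.accept (l * (m + 1) + j) (by rwa [depth_cycle l (by omega)]) hl
      rw [cycleDiff, ← add_assoc, e, h.candidate_eq l j (by omega) hj0]
      abel
  X_isBigO i hi := h.cycleDiff_isBigO (by omega)
  Y_approx i hi := h.gradient_expansion h.start_isBigO
    (h.iterate_isBigO (i := i + 1) (by omega))
  cond := by
    have hL := h.L_pos
    exact ⟨1 / (L * (M ^ 2 + 1)), by positivity,
      Eventually.of_forall fun l b i hi => h.coeff_le l hk b hi⟩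

end IsLocalRun

end Local

/-- This is where `ν < 3` enters: `t ^ (3 - ν)` tends to zero. -/
lemma eventually_cube_le_min {ι : Type*} {F : Filter ι} {t : ι → ℝ} (ht : Tendsto t F (𝓝 0))
    (ht0 : ∀ l, 0 < t l) {ν c₁ c₂ c₃ : ℝ} (hc₁ : 0 < c₁) (hc₂ : 0 < c₂) (hc₃ : 0 < c₃)
    (hν : ν < 3) (C : ℝ) :
    ∀ᶠ l in F, C * t l ^ 3 ≤ min (c₁ * t l ^ ν) (min (c₂ * t l ^ 2) c₃) := by
  have h1 : Tendsto (fun l => C * t l ^ (3 - ν)) F (𝓝 0) := by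
    have := ((Real.continuousAt_rpow_const 0 (3 - ν) (Or.inr (by linarith))).tendsto.comp
      ht).const_mul C
    rw [Real.zero_rpow (by linarith), mul_zero] at this
    exact this
  have h2 : Tendsto (fun l => C * t l) F (𝓝 0) := by simpa using ht.const_mul C
  have h3 : Tendsto (fun l => C * t l ^ 3) F (𝓝 0) := by simpa using (ht.pow 3).const_mul C
  filter_upwards [h1.eventually (gt_mem_nhds hc₁), h2.eventually (gt_mem_nhds hc₂),
    h3.eventually (gt_mem_nhds hc₃)] with l hl1 hl2 hl3
  have htl := ht0 l
  refine le_min ?_ (le_min ?_ hl3.le)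
  · have e : t l ^ 3 = t l ^ (3 - ν) * t l ^ ν := by
      rw [← Real.rpow_add htl, sub_add_cancel, ← Real.rpow_natCast]; norm_num
    rw [e, ← mul_assoc]
    gcongr
  · have e : C * t l ^ 3 = C * t l * t l ^ 2 := by ring
    rw [e]
    gcongr

/-! ### Eventual acceptance and convergence of the cycle starts. -/

section Local

open Asymptotics

variable {n : ℕ} {f : EuclideanSpace ℝ (Fin n) → ℝ} {L : ℝ} {m : ℕ} {γ ν c₁ c₂ c₃ : ℝ}
  {x z : ℕ → EuclideanSpace ℝ (Fin n)} {xstar : EuclideanSpace ℝ (Fin n)} {r μ LH M : ℝ}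
  {α : ℕ → ℕ → ℕ → ℝ}

namespace IsLocalRun

variable (h : IsLocalRun f L m γ ν c₁ c₂ c₃ x z xstar r μ LH M α)
include h

lemma tendsto_of_isBigO {u : ℕ → EuclideanSpace ℝ (Fin n)}
    (hu : (fun l => u l - xstar) =O[comap (fun l => x (l * (m + 1))) (𝓝 xstar)]
      fun l => ‖gradient f (x (l * (m + 1)))‖) :
    Tendsto u (comap (fun l => x (l * (m + 1))) (𝓝 xstar)) (𝓝 xstar) :=
  tendsto_sub_nhds_zero_iff.1 (hu.trans_tendsto h.tendsto_norm_gradient_start)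

lemma norm_le_norm_hessian (y : EuclideanSpace ℝ (Fin n)) :
    μ * ‖y‖ ≤ ‖fderiv ℝ (gradient f) xstar y‖ := by
  have h1 := le_hessian_inner h.smooth.1 h.r_pos
    (h.hessian.1 xstar (Metric.mem_ball_self h.r_pos)) h.strongConvex y
  have h2 := real_inner_le_norm y (fderiv ℝ (gradient f) xstar y)
  rcases (norm_nonneg y).eq_or_lt with h0 | h0
  · rw [← h0, mul_zero]; exact norm_nonneg _
  · refine le_of_mul_le_mul_left ?_ h0
    linarith

lemma candidate_isBigO {k : ℕ} (hk : k ≤ m) (hk0 : k ≠ 0)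
    (hacc : ∀ j < k, j ≠ 0 → ∀ᶠ l in comap (fun l => x (l * (m + 1))) (𝓝 xstar),
      Accepted f m γ ν c₁ c₂ c₃ x (l * (m + 1) + j) (z (l * (m + 1) + j))) :
    (fun l => z (l * (m + 1) + k) - xstar) =O[comap (fun l => x (l * (m + 1))) (𝓝 xstar)]
      fun l => ‖gradient f (x (l * (m + 1)))‖ := by
  have hN := h.isNearlyLinearAA hk hacc
  have h1 := hN.D_isBigO h.μ_pos h.norm_le_norm_hessian le_rfl
  have h2 := (hN.R_isBigO le_rfl).const_smul_left (1 / L)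
  refine ((h1.sub h2).add h.start_isBigO).congr_left fun l => ?_
  rw [h.candidate_eq l k hk hk0]
  simp only [Pi.smul_apply]
  abel

lemma eventually_accepted_of_lt (hγ : γ < 1 / (2 * L)) (hc₁ : 0 < c₁) (hc₂ : 0 < c₂)
    (hc₃ : 0 < c₃) (hν : ν < 3) {p : ℕ} (hk : p + 1 ≤ m)
    (hacc : ∀ j < p + 1, j ≠ 0 → ∀ᶠ l in comap (fun l => x (l * (m + 1))) (𝓝 xstar),
      Accepted f m γ ν c₁ c₂ c₃ x (l * (m + 1) + j) (z (l * (m + 1) + j))) :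
    ∀ᶠ l in comap (fun l => x (l * (m + 1))) (𝓝 xstar),
      Accepted f m γ ν c₁ c₂ c₃ x (l * (m + 1) + (p + 1)) (z (l * (m + 1) + (p + 1))) := by
  have hN := h.isNearlyLinearAA hk hacc
  have hL := h.L_pos
  have hdiff := h.hessian.1 xstar (Metric.mem_ball_self h.r_pos)
  have hsymm := hessian_symm h.smooth.1 hdiff
  have hlow := le_hessian_inner h.smooth.1 h.r_pos hdiff h.strongConvex
  have hub := hessian_inner_le (xstar := xstar) hL h.smooth
  have hpos : ∀ y, y ≠ 0 → 0 < ⟪y, fderiv ℝ (gradient f) xstar y⟫_ℝ := fun y hy =>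
    lt_of_lt_of_le (mul_pos h.μ_pos (pow_pos (norm_pos_iff.2 hy) 2)) (hlow y)
  have hcoc := norm_sq_map_le_of_symm hL hsymm
    (fun y => (mul_nonneg h.μ_pos.le (sq_nonneg _)).trans (hlow y)) hub
  have hzO := h.candidate_isBigO hk (Nat.succ_ne_zero p) hacc
  have hG : (fun l => gradient f (z (l * (m + 1) + (p + 1))) -
      mixedValue m (fun k => gradient f (x k)) α l 0 - fderiv ℝ (gradient f) xstar
        (mixedDiff m x α l (p + 1) -
          (1 / L) • mixedValue m (fun k => gradient f (x k)) α l (p + 1)))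
      =O[comap (fun l => x (l * (m + 1))) (𝓝 xstar)]
      fun l => ‖gradient f (x (l * (m + 1)))‖ ^ 2 := by
    refine (h.gradient_expansion h.start_isBigO hzO).congr_left fun l => ?_
    have e : z (l * (m + 1) + (p + 1)) - x (l * (m + 1)) = mixedDiff m x α l (p + 1) -
        (1 / L) • mixedValue m (fun k => gradient f (x k)) α l (p + 1) := by
      rw [h.candidate_eq l (p + 1) hk (Nat.succ_ne_zero p)]; abel
    rw [e]
    simp [mixedValue, mixedDiff]
  obtain ⟨C, hC⟩ := hN.gradient_gain_lower_bound rfl hL hsymm hpos hcoc hub h.μ_pos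
    h.norm_le_norm_hessian hG
  have hgcont : Continuous (gradStep f L) :=
    continuous_id.sub (h.continuous_gradient.const_smul (1 / L))
  have hgfix : gradStep f L xstar = xstar := by simp [gradStep, h.gradient_eq_zero]
  have hg : Tendsto (fun l => gradStep f L (x (l * (m + 1) + (p + 1))))
      (comap (fun l => x (l * (m + 1))) (𝓝 xstar)) (𝓝 xstar) := by
    have := (hgcont.tendsto xstar).comp (h.tendsto_of_isBigO (h.iterate_isBigO hk))
    rwa [hgfix] at this
  have hball := Metric.ball_mem_nhds xstar h.r_pos
  -- The tolerance is the slack between the guaranteed decrease of a gradient step and the required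
  -- one.
  filter_upwards [hC (1 / (2 * L) - γ) (by linarith),
    (h.tendsto_of_isBigO hzO).eventually hball, hg.eventually hball,
    eventually_cube_le_min h.tendsto_norm_gradient_start h.norm_gradient_pos hc₁ hc₂ hc₃ hν C]
    with l hl hzl hgl hml
  set k := l * (m + 1) + (p + 1) with hkdef
  have h1 := strongConvex_gradient_le h.smooth.1 h.strongConvex hzl hgl
  have h2 := gradStep_descent hL h.smooth (x k)
  set R := mixedValue m (fun k => gradient f (x k)) α l (p + 1) with hR
  set q := mixedValue m (fun k => gradient f (x k)) α l 0 +
    cycleDiff m (fun k => gradient f (x k)) l p - R with hq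
  have hgk : gradient f (x k) = R + q := by
    rw [hq, add_sub_cancel]
    simp [mixedValue, mixedDiff, cycleDiff, hkdef]
  have e : gradStep f L (x k) - z k =
      cycleDiff m x l p - mixedDiff m x α l (p + 1) - (1 / L) • q := by
    rw [gradStep, hgk, h.candidate_eq l (p + 1) hk (Nat.succ_ne_zero p), cycleDiff]
    rw [← hR, ← hkdef, smul_add]
    abel
  rw [e] at h1
  have horth : ⟪R, q⟫_ℝ = 0 := by
    rw [hq, inner_sub_right, inner_add_right, hN.inner_R_sub l le_rfl (Nat.zero_le _),
      hN.orth l (p + 1) le_rfl p (Nat.lt_succ_self p), real_inner_self_eq_norm_sq]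
    ring
  -- The current gradient splits orthogonally as `R + q`.
  have hRle : ‖R‖ ^ 2 ≤ ‖gradient f (x k)‖ ^ 2 := by
    rw [hgk, norm_add_sq_real, horth]
    nlinarith [sq_nonneg ‖q‖]
  have h3 := mul_le_mul_of_nonneg_left hRle (by linarith : 0 ≤ 1 / (2 * L) - γ)
  have h4 : 0 ≤ μ / 2 *
      ‖cycleDiff m x l p - mixedDiff m x α l (p + 1) - (1 / L) • q‖ ^ 2 := by
    have := h.μ_pos
    positivity
  unfold Accepted
  rw [hkdef, depth_cycle l hk, Nat.add_sub_cancel, ← hkdef]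
  linarith

lemma eventually_accepted (hγ : γ < 1 / (2 * L)) (hc₁ : 0 < c₁) (hc₂ : 0 < c₂)
    (hc₃ : 0 < c₃) (hν : ν < 3) {j : ℕ} (hj : j ≤ m) (hj0 : j ≠ 0) :
    ∀ᶠ l in comap (fun l => x (l * (m + 1))) (𝓝 xstar),
      Accepted f m γ ν c₁ c₂ c₃ x (l * (m + 1) + j) (z (l * (m + 1) + j)) := by
  induction j using Nat.strong_induction_on with
  | _ j ih =>
    obtain ⟨p, rfl⟩ := Nat.exists_eq_succ_of_ne_zero hj0
    exact h.eventually_accepted_of_lt hγ hc₁ hc₂ hc₃ hν hj fun j hj' hj0' =>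
      ih j hj' (by omega) hj0'

lemma tendsto_next_start (hγ : γ < 1 / (2 * L)) (hc₁ : 0 < c₁) (hc₂ : 0 < c₂)
    (hc₃ : 0 < c₃) (hν : ν < 3) :
    Tendsto (fun l => x ((l + 1) * (m + 1))) (comap (fun l => x (l * (m + 1))) (𝓝 xstar))
      (𝓝 xstar) := by
  have hm0 : m ≠ 0 := by have := h.m_pos; omega
  have hz := h.tendsto_of_isBigO (h.candidate_isBigO le_rfl hm0 fun j hj hj0 =>
    h.eventually_accepted hγ hc₁ hc₂ hc₃ hν hj.le hj0)
  refine hz.congr' ?_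
  filter_upwards [h.eventually_accepted hγ hc₁ hc₂ hc₃ hν le_rfl hm0] with l hl
  rw [← h.run.accept (l * (m + 1) + m) (by rwa [depth_cycle l le_rfl]) hl]
  congr 1
  ring

/-- A trapping argument: a start in the ball of radius `ρ` with value below `f xstar + μ / 2 * ρ ^
2` is followed by another such start. Inside the ball the distance to `xstar` is controlled by the
gradient, which tends to zero. -/
lemma tendsto_start (hdesc : ∀ l, f (x ((l + 1) * (m + 1))) ≤ f (x (l * (m + 1))))
    (hgrad : Tendsto (fun k => ‖gradient f (x k)‖) atTop (𝓝 0))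
    (hclust : MapClusterPt xstar atTop (fun l => x (l * (m + 1))))
    (hγ : γ < 1 / (2 * L)) (hc₁ : 0 < c₁) (hc₂ : 0 < c₂) (hc₃ : 0 < c₃) (hν : ν < 3) :
    Tendsto (fun l => x (l * (m + 1))) atTop (𝓝 xstar) := by
  have hr := h.r_pos
  have hμ := h.μ_pos
  have hball := Metric.ball_mem_nhds xstar hr
  obtain ⟨U, hU, hUsub⟩ := mem_comap.1
    ((h.tendsto_next_start hγ hc₁ hc₂ hc₃ hν).eventually hball)
  obtain ⟨δ, hδ, hδU⟩ := Metric.mem_nhds_iff.1 hU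
  set ρ := min δ r with hρ
  have hρ0 : 0 < ρ := lt_min hδ hr
  have hgrow : ∀ y ∈ Metric.ball xstar r, f xstar + μ / 2 * ‖y - xstar‖ ^ 2 ≤ f y := by
    intro y hy
    have := strongConvex_gradient_le h.smooth.1 h.strongConvex (Metric.mem_ball_self hr) hy
    rwa [h.gradient_eq_zero, inner_zero_left, add_zero] at this
  have hnhds : ∀ᶠ y in 𝓝 xstar, ‖y - xstar‖ < ρ ∧ f y < f xstar + μ / 2 * ρ ^ 2 := by
    refine (eventually_norm_sub_lt xstar hρ0).and
      (h.smooth.1.continuous.continuousAt.eventually (gt_mem_nhds ?_))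
    have : 0 < μ / 2 * ρ ^ 2 := by positivity
    linarith
  obtain ⟨l₀, hl₀⟩ := (hclust.frequently hnhds).exists
  have htrap : ∀ l, l₀ ≤ l → ‖x (l * (m + 1)) - xstar‖ < ρ ∧
      f (x (l * (m + 1))) < f xstar + μ / 2 * ρ ^ 2 := by
    intro l hl
    induction l, hl using Nat.le_induction with
    | base => exact hl₀
    | succ l hl ih =>
      have hlt := (hdesc l).trans_lt ih.2
      refine ⟨?_, hlt⟩
      -- Closeness of consecutive starts only gives the ball of radius `r`; descent and quadratic
      -- growth then sharpen this to `ρ`.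
      have hin : x ((l + 1) * (m + 1)) ∈ Metric.ball xstar r :=
        hUsub (hδU (mem_ball_iff_norm.2 (ih.1.trans_le (min_le_left _ _))))
      have h1 := (hgrow _ hin).trans_lt hlt
      refine lt_of_pow_lt_pow_left₀ 2 hρ0.le ?_
      have h2 : μ / 2 * ‖x ((l + 1) * (m + 1)) - xstar‖ ^ 2 < μ / 2 * ρ ^ 2 := by linarith
      exact lt_of_mul_lt_mul_left h2 (by positivity)
  rw [← tendsto_sub_nhds_zero_iff]
  have hlim : Tendsto (fun l => 1 / μ * ‖gradient f (x (l * (m + 1)))‖) atTop (𝓝 0) := by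
    have := (hgrad.comp (tendsto_id.atTop_mul_const' (Nat.succ_pos m))).const_mul (1 / μ)
    rwa [mul_zero] at this
  refine squeeze_zero_norm' ?_ hlim
  filter_upwards [eventually_ge_atTop l₀] with l hl
  have := h.norm_sub_le_gradient (mem_ball_iff_norm.2 ((htrap l hl).1.trans_le (min_le_right _ _)))
  rw [one_div, inv_mul_eq_div, le_div_iff₀ hμ]
  linarith

end IsLocalRun

end Local


end AndersonRestart

/-! ### The main theorem. -/

open AndersonRestart in
theorem theorem4p1 {n : ℕ} (f : EuclideanSpace ℝ (Fin n) → ℝ) (L : ℝ) (hL : 0 < L)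
    (hf : AndersonRestart.IsLSmooth f L) (hbdd : BddBelow (Set.range f))
    (m : ℕ) (hm : 1 ≤ m) (γ ν c₁ c₂ c₃ : ℝ)
    (hγ : 0 < γ) (hc₁ : 0 < c₁) (hc₃ : 0 < c₃)
    (hc₂ : 0 < c₂) (hc₂' : c₂ < 1 / (2 * (m : ℝ) * L)) (hν : ν ∈ Set.Ioo (2 : ℝ) 3)
    (x z : ℕ → EuclideanSpace ℝ (Fin n))
    (hx : AndersonRestart.IsGlobalizedAAR f L m γ ν c₁ c₂ c₃ x z) :
    Summable (fun k => ‖gradient f (x k)‖ ^ 2) ∧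
    Tendsto (fun k => ‖gradient f (x k)‖) atTop (𝓝 0) ∧
    (γ < 1 / (2 * L) →
      ∀ (xstar : EuclideanSpace ℝ (Fin n)) (r μ LH M : ℝ), 0 < r → 0 < μ →
        MapClusterPt xstar atTop (fun k => x (k * (m + 1))) →
        StrongConvexOn (Metric.ball xstar r) μ f →
        AndersonRestart.HessianLipschitzOn f LH (Metric.ball xstar r) →
        AndersonRestart.CondBound m x M →
        Tendsto x atTop (𝓝 xstar) ∧
        (∃ K : ℕ, ∀ k, K ≤ k → AndersonRestart.depth m k ≠ 0 →
          AndersonRestart.Accepted f m γ ν c₁ c₂ c₃ x k (z k) ∧ x (k + 1) = z k) ∧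
        (∃ s : ℕ, AndersonRestart.IsAAR f L m (fun k => x (s * (m + 1) + k)))) := by

  have hsum := summable_sq_gradient hL hf hbdd hm hγ hc₂ hc₂' hx
  have hgrad := tendsto_norm_gradient hsum
  refine ⟨hsum, hgrad, fun hγL xstar r μ LH M hr hμ hclust hsc hH hcond => ?_⟩
  have hcycle : Tendsto (fun l : ℕ => l * (m + 1)) atTop atTop :=
    tendsto_id.atTop_mul_const' (Nat.succ_pos m)
  -- An accumulation point is stationary because the gradient is continuous and tends to zero along
  -- the iterates.
  have hzero : gradient f xstar = 0 := by
    by_contra hne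
    have hpos : 0 < ‖gradient f xstar‖ / 2 := half_pos (norm_pos_iff.2 hne)
    have h1 := hclust.frequently ((hf.lipschitzWith hL).continuous.norm.continuousAt.eventually
      (lt_mem_nhds (half_lt_self (norm_pos_iff.2 hne))))
    obtain ⟨l, hl1, hl2⟩ := (h1.and_eventually
      ((hgrad.comp hcycle).eventually (gt_mem_nhds hpos))).exists
    exact lt_asymm hl1 hl2
  obtain ⟨α, horth, hcand⟩ := exists_mixing hL hx
  have h : IsLocalRun f L m γ ν c₁ c₂ c₃ x z xstar r μ LH M α :=
    ⟨hL, hf, hx, hm, hr, hμ, hzero, hsc, hH, hcond, horth, hcand⟩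
  have hdesc : ∀ l, f (x ((l + 1) * (m + 1))) ≤ f (x (l * (m + 1))) := by
    obtain ⟨δ, hδ, hδl⟩ := cycle_decrease hL hf hm hγ hc₂ hc₂' hx
    intro l
    have := hδl l
    have h0 : 0 ≤ δ * ∑ j ∈ Finset.range (m + 1), ‖gradient f (x (l * (m + 1) + j))‖ ^ 2 := by
      positivity
    linarith
  have hstart := h.tendsto_start hdesc hgrad hclust hγL hc₁ hc₂ hc₃ hν.2
  have hle : atTop ≤ comap (fun l => x (l * (m + 1))) (𝓝 xstar) := tendsto_iff_comap.1 hstart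
  have hdiv : Tendsto (fun k : ℕ => k / (m + 1)) atTop atTop :=
    Nat.tendsto_div_const_atTop (Nat.succ_ne_zero m)
  have hdm : ∀ k : ℕ, k / (m + 1) * (m + 1) + k % (m + 1) = k := fun k => by
    rw [mul_comm]; exact Nat.div_add_mod k (m + 1)
  have hmod : ∀ k : ℕ, k % (m + 1) ≤ m := fun k => Nat.lt_succ_iff.1 (Nat.mod_lt k (Nat.succ_pos m))
  have hlim : Tendsto x atTop (𝓝 xstar) := by
    refine tendsto_def.2 fun U hU => ?_
    have h1 : ∀ᶠ l in atTop, ∀ i ∈ Set.Iic m, x (l * (m + 1) + i) ∈ U :=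
      (eventually_all_finite (Set.finite_Iic m)).2 fun i hi =>
        ((h.tendsto_of_isBigO (h.iterate_isBigO hi)).mono_left hle).eventually hU
    filter_upwards [hdiv.eventually h1] with k hk
    have := hk (k % (m + 1)) (hmod k)
    rwa [hdm] at this
  have hall : ∀ᶠ k in atTop, depth m k ≠ 0 →
      Accepted f m γ ν c₁ c₂ c₃ x k (z k) ∧ x (k + 1) = z k := by
    have h1 : ∀ᶠ l in atTop, ∀ i ∈ Set.Iic m, i ≠ 0 →
        Accepted f m γ ν c₁ c₂ c₃ x (l * (m + 1) + i) (z (l * (m + 1) + i)) := by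
      refine (eventually_all_finite (Set.finite_Iic m)).2 fun i hi => ?_
      by_cases hi0 : i = 0
      · exact Eventually.of_forall fun l h0 => absurd hi0 h0
      · exact ((h.eventually_accepted hγL hc₁ hc₂ hc₃ hν.2 hi hi0).filter_mono hle).mono
          fun l hl _ => hl
    filter_upwards [hdiv.eventually h1] with k hk hk0
    have h2 := hk (k % (m + 1)) (hmod k) hk0
    rw [hdm] at h2
    exact ⟨h2, hx.accept k hk0 h2⟩
  obtain ⟨K, hK⟩ := eventually_atTop.1 hall
  -- Shifting by `K` whole cycles starts at a restart and at an index no smaller than `K`.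
  refine ⟨hlim, ⟨K, hK⟩, K, ⟨fun k hk => ?_, fun k hk => ?_⟩⟩
  · have hd : depth m (K * (m + 1) + k) = 0 := by
      rw [← hk, depth, depth, add_comm, Nat.add_mul_mod_self_right]
    exact hx.restart (K * (m + 1) + k) hd
  · have hd : depth m (K * (m + 1) + k) ≠ 0 := by
      have : depth m (K * (m + 1) + k) = depth m k := by
        rw [depth, depth, add_comm, Nat.add_mul_mod_self_right]
      rwa [this]
    rw [isAAStep_shift_iff]
    have h1 := (hK (K * (m + 1) + k)
      ((Nat.le_mul_of_pos_right K (Nat.succ_pos m)).trans (Nat.le_add_right _ _)) hd).2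
    show IsAAStep f L m x (K * (m + 1) + k) (x (K * (m + 1) + k + 1))
    rw [h1]
    exact hx.candidate _ hd
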